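/- **Setting.** Let $D\subset\mathbb R^d$, let $w\sim\Pi=\mathrm{GP}\{0,C\}$ be a centred Gaussian process prior on functions $w:D\to\mathbb R$ with known covariance function $C$, and let $\tau^2>0$ be a known noise variance. Fix test locations $\mathcal S^*=\{s_1^*,\dots,s_l^*\}\subset D$ for which the matrix $C_{*,*}=(C(s_a^*,s_b^*))_{a,b}$ is positive definite, and write $w^*=(w(s_1^*),\dots,w(s_l^*))^T$. For every $m\ge 1$ let $\mathcal S=\mathcal S^{(m)}$ be a family of $n=mk$ locations $s_{ji}\in D\setminus\mathcal S^*$ ($1\le j\le k$, $1\le i\le m$), where $k=k_m\ge1$, partitioned into the subsets $\mathcal S_j=(s_{j1},\dots,s_{jm})$. With the cross-covariance matrices $C_{j,j}$ (of $\mathcal S_j$ with itself) and $C_{*j}$ (of $\mathcal S^*$ with $\mathcal S_j$) put $$A_j=C_{*j}^TC_{*,*}^{-1},\qquad \Sigma_j=k^{-1}\tau^2 I+C_{j,j}-C_{*j}^TC_{*,*}^{-1}C_{*j},\qquad \|b\|_{\mathcal S_j}=\Big(\tfrac1m\,b^TA_j^T\Sigma_j^{-1}A_jb\Big)^{1/2}\quad(b\in\mathbb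 R^l),$$ and let $A,\Sigma$ be given by the same formulas (with the same noise variance $k^{-1}\tau^2$) for all $n$ locations of $\mathcal S$, with $\|b\|_{\mathcal S}=(\frac1n b^TA^T\Sigma^{-1}Ab)^{1/2}$; for a function $f$ put $\|f\|_{\mathcal S}=\|f^*\|_{\mathcal S}$. The model for the $j$th data subset after stochastic approximation is $y_j\mid w\sim N(A_jw^*,\Sigma_j)$. The $j$th subset posterior $\Pi_m(\cdot\mid y_j)$ is the posterior of $w$ obtained by Bayes' formula from the prior $\Pi$ and this likelihood. The DISK posterior $\overline\Pi(\cdot\mid y_1,\dots,y_k)$ is the 2-Wasserstein barycenter in $(\mathbb R^l,\|\cdot\|_2)$ of the $k$ subset posteriors of $w^*$, that is, the minimizer $\nu$ of $\frac1k\sum_{j=1}^kW_2^2(\nu,\nu_j)$ among the probability measures with finite second moment, where $\nu_j$ is the law of $w^*$ under $\Pi_m(\cdot\mid y_j)$. Let $w_0:D\to\mathbb R$ be the true function, $w_0^*$ its vector of values on $\mathcal S^*$. Let $\mathbb E_{0\mid\mathcal S_j,\mathcal S^*}$ be the expectation for $y_j\sim N(A_jw_0^*,\Sigma_j)$ and $\mathbb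 E_{0\mid\mathcal S,\mathcal S^*}$ the expectation for the full data $y=(y_1,\dots,y_k)\sim N(Aw_0^*,\Sigma)$. **Theorem.** There is a positive constant $c(H_l)$ that depends only on $H_l$ with the following property. Suppose that $0<H_l<1<H_u$ and $C_l,C_u>0$ are constants (not depending on $m$ or $j$) and $(\epsilon_m)$ is a positive sequence such that 1. (compact domain) $D$ is compact; 2. (norm equivalence) $H_l\|b\|_{\mathcal S}\le\|b\|_{\mathcal S_j}\le H_u\|b\|_{\mathcal S}$ for all $m\ge1$, $j\le k$, $b\in\mathbb R^l$; 3. (metric entropy) $\sqrt m\,\epsilon_m\ge1$ for all $m\ge1$, $\epsilon_m\to0$, and for every $r>1$ and $m\ge1$ there is a measurable set of functions $\mathcal F_r=\mathcal F_{r,m}$ that can be covered by at most $e^{m\epsilon_m^2H_l^2r^2}$ $\|\cdot\|_{\mathcal S}$-balls of radius $\epsilon_m$ and has prior mass $\Pi(\mathcal F_r)\ge1-e^{-2m\epsilon_m^2r^2}$; 4. (prior thickness) $\Pi(w:\|w^*-w_0^*\|_{\mathcal S}\le\epsilon_m)\ge e^{-mH_u^2\epsilon_m^2}$ for all $m\ge1$;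 5. $C_l\|b\|_{\mathcal S}^2\le\|b\|_2^2\le C_u\|b\|_{\mathcal S}^2$ for all $m\ge1$, $b\in\mathbb R^l$. Then, for all sufficiently large $m$, $$\mathbb E_{0\mid\mathcal S_j,\mathcal S^*}\Big\{\int\|w^*-w_0^*\|_2^2\,d\Pi_m(w\mid y_j)\Big\}\le C_u\,c(H_l)\,\epsilon_m^2,\qquad j=1,\dots,k,$$ $$\mathbb E_{0\mid\mathcal S,\mathcal S^*}\Big\{\int\|w^*-w_0^*\|_2^2\,d\overline\Pi(w^*\mid y_1,\dots,y_k)\Big\}\le C_u^2\,c(H_l)\,\epsilon_m^2.$$ -/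

import Mathlib

open MeasureTheory ProbabilityTheory Filter Topology
open scoped ENNReal Matrix

namespace DISK

noncomputable section

/-- The law `P` on functions `w : D → ℝ` (with the product σ-algebra) is the centred Gaussian
process law `GP{0, C}` with covariance function `C`. -/
structure IsGPPrior {D : Type*} (C : D → D → ℝ) (P : Measure (D → ℝ)) : Prop where
  gaussian : IsGaussianProcess (fun (s : D) (w : D → ℝ) => w s) P
  mean_zero : ∀ s, ∫ w, w s ∂P = 0
  cov : ∀ s t, covariance (fun w : D → ℝ => w s) (fun w => w t) P = C s t

/-- The vector of values `w(x₁), …, w(x_N)` of a function `w` at a finite family of locations. -/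
def evalAt {D ι : Type*} (x : ι → D) (w : D → ℝ) : EuclideanSpace ℝ ι :=
  WithLp.toLp 2 (fun i => w (x i))

/-- The matrix `(C(x_i, z_j))_{i,j}`. -/
def covMatrix {D ι κ : Type*} (C : D → D → ℝ) (x : ι → D) (z : κ → D) : Matrix ι κ ℝ :=
  Matrix.of fun i j => C (x i) (z j)

/-- `A = C_{*x}ᵀ C_{*,*}⁻¹` for observed locations `x` and test locations `t`. -/
def regMatrix {D ι : Type*} {l : ℕ} (C : D → D → ℝ) (t : Fin l → D) (x : ι → D) :
    Matrix ι (Fin l) ℝ :=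
  (covMatrix C t x)ᵀ * (covMatrix C t t)⁻¹

/-- `Σ = v I + C_{x,x} - C_{*x}ᵀ C_{*,*}⁻¹ C_{*x}`, with noise variance `v`. -/
def condCov {D ι : Type*} [DecidableEq ι] {l : ℕ} (C : D → D → ℝ) (v : ℝ)
    (t : Fin l → D) (x : ι → D) : Matrix ι ι ℝ :=
  v • (1 : Matrix ι ι ℝ) + covMatrix C x x
    - (covMatrix C t x)ᵀ * (covMatrix C t t)⁻¹ * covMatrix C t x

/-- The data-dependent norm `(N⁻¹ bᵀ Aᵀ Σ⁻¹ A b)^{1/2}` on `ℝˡ`, for `N` observed locations `x`. -/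
def dataNorm {D ι : Type*} [Fintype ι] [DecidableEq ι] {l : ℕ} (C : D → D → ℝ) (v : ℝ)
    (t : Fin l → D) (x : ι → D) (b : EuclideanSpace ℝ (Fin l)) : ℝ :=
  Real.sqrt ((1 / (Fintype.card ι : ℝ)) *
    ((regMatrix C t x *ᵥ b.ofLp) ⬝ᵥ ((condCov C v t x)⁻¹ *ᵥ (regMatrix C t x *ᵥ b.ofLp))))

/-- The density at `y` of the Gaussian law `N(μ, S)`, for positive definite `S`. -/
def gaussianDensity {ι : Type*} [Fintype ι] [DecidableEq ι] (μ : EuclideanSpace ℝ ι)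
    (S : Matrix ι ι ℝ) (y : EuclideanSpace ℝ ι) : ℝ :=
  (Real.sqrt ((2 * Real.pi) ^ Fintype.card ι * S.det))⁻¹ *
    Real.exp (-(1 / 2) * ((y - μ).ofLp ⬝ᵥ (S⁻¹ *ᵥ (y - μ).ofLp)))

/-- The mean `A b` of the data at the locations `x` when the test values are `b`. -/
def dataMean {D ι : Type*} {l : ℕ} (C : D → D → ℝ) (t : Fin l → D) (x : ι → D)
    (b : EuclideanSpace ℝ (Fin l)) : EuclideanSpace ℝ ι :=
  WithLp.toLp 2 (regMatrix C t x *ᵥ b.ofLp)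

/-- The law `N(A b, Σ)` of the data at the locations `x` when the test values are `b`. -/
def dataLaw {D ι : Type*} [Fintype ι] [DecidableEq ι] {l : ℕ} (C : D → D → ℝ) (v : ℝ)
    (t : Fin l → D) (x : ι → D) (b : EuclideanSpace ℝ (Fin l)) :
    Measure (EuclideanSpace ℝ ι) :=
  multivariateGaussian (dataMean C t x b) (condCov C v t x)

/-- The likelihood of the function `w` given the data `y` at the locations `x`: the `N(A w*, Σ)`
density at `y`, where `w*` is the vector of test values of `w`. -/
def likelihood {D ι : Type*} [Fintype ι] [DecidableEq ι] {l : ℕ} (C : D → D → ℝ) (v : ℝ)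
    (t : Fin l → D) (x : ι → D) (y : EuclideanSpace ℝ ι) (w : D → ℝ) : ℝ≥0∞ :=
  ENNReal.ofReal (gaussianDensity (dataMean C t x (evalAt t w)) (condCov C v t x) y)

/-- The posterior law of the function `w` given `y`, by Bayes' formula from the prior `P`. -/
def posterior {D ι : Type*} [Fintype ι] [DecidableEq ι] {l : ℕ} (C : D → D → ℝ) (v : ℝ)
    (t : Fin l → D) (P : Measure (D → ℝ)) (x : ι → D) (y : EuclideanSpace ℝ ι) :
    Measure (D → ℝ) :=
  (∫⁻ w, likelihood C v t x y w ∂P)⁻¹ • P.withDensity (likelihood C v t x y)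

/-- The posterior law of the vector `w*` of test values given `y`. -/
def testPosterior {D ι : Type*} [Fintype ι] [DecidableEq ι] {l : ℕ} (C : D → D → ℝ) (v : ℝ)
    (t : Fin l → D) (P : Measure (D → ℝ)) (x : ι → D) (y : EuclideanSpace ℝ ι) :
    Measure (EuclideanSpace ℝ (Fin l)) :=
  (posterior C v t P x y).map (evalAt t)

/-- The part `y_j` of the full data `y` that belongs to the `j`-th subset. -/
def subsetData {k m : ℕ} (y : EuclideanSpace ℝ (Fin k × Fin m)) (j : Fin k) :
    EuclideanSpace ℝ (Fin m) :=
  WithLp.toLp 2 (fun i => y (j, i))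

/-- The locations of all subsets together, `s_{ji}` with index `(j, i)`. -/
def fullLoc {D : Type*} {k m : ℕ} (x : Fin k → Fin m → D) : Fin k × Fin m → D :=
  fun p => x p.1 p.2

/-- The minimal number (possibly `∞`) of balls `{f | N (f - g) ≤ ε}` of a seminorm `N` that
cover the set `F`. -/
def ballCoverNumber {X : Type*} [AddGroup X] (N : X → ℝ) (ε : ℝ) (F : Set X) : ℕ∞ :=
  ⨅ (T : Finset X) (_ : ∀ f ∈ F, ∃ g ∈ T, N (f - g) ≤ ε), (T.card : ℕ∞)

/-- The squared 2-Wasserstein distance `W₂²(μ, ν)`: the infimum of `∫ ρ(x, y)² dπ(x, y)` over all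
couplings `π` of `μ` and `ν`. -/
def wassersteinSq {E : Type*} [MeasurableSpace E] [EDist E] (μ ν : Measure E) : ℝ≥0∞ :=
  ⨅ (π : Measure (E × E)) (_ : π.map Prod.fst = μ ∧ π.map Prod.snd = ν),
    ∫⁻ p, edist p.1 p.2 ^ 2 ∂π

/-- `ν` is a probability measure with finite second moment. -/
def MemP2 {E : Type*} [MeasurableSpace E] [NormedAddCommGroup E] (ν : Measure E) : Prop :=
  IsProbabilityMeasure ν ∧ ∫⁻ x, ‖x‖ₑ ^ 2 ∂ν < ∞

/-- `ν` is a Wasserstein barycenter of `ν₁, …, ν_k`: it minimizes `k⁻¹ ∑ⱼ W₂²(·, νⱼ)` among the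
probability measures with finite second moment. -/
def IsBarycenter {E : Type*} [MeasurableSpace E] [NormedAddCommGroup E] {k : ℕ}
    (νs : Fin k → Measure E) (ν : Measure E) : Prop :=
  MemP2 ν ∧ ∀ ν' : Measure E, MemP2 ν' →
    (k : ℝ≥0∞)⁻¹ * ∑ j, wassersteinSq ν (νs j) ≤ (k : ℝ≥0∞)⁻¹ * ∑ j, wassersteinSq ν' (νs j)

end

end DISK

/-! The vector `w*` has fixed dimension `l`, its prior is Gaussian with covariance `C_{*,*}`, and
the likelihood is Gaussian with information matrix `AᵀΣ⁻¹A`. The quadratic form of this matrix is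
`m` times the squared subset norm, and the norm equivalences compare that norm with the Euclidean
one. So the information grows linearly in `m`, and each subset posterior has risk at most `B / m`,
with `B` free of `m` and `j`. For fixed data, completing the square
(`lintegral_sq_mul_gaussian_tilt_le`) bounds the risk through the score; averaged over the data, the
squared score has mean `trace (AᵀΣ⁻¹A)`, which is of order `m` (`exists_posterior_risk_bound`).

The rate `ε_m` is strictly slower than this. The entropy condition with `r = 2` covers at least half
of the prior mass by `exp (4 H_l² m ε_m²)` balls. Each ball confines one test value, a nondegenerate
Gaussian variable, to an interval of length of order `ε_m`, so it has prior mass `O(ε_m)`. As `ε_m →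
0`, the number of balls must blow up, which forces `m ε_m² → ∞` (`tendsto_mul_sq_atTop`). Hence `B /
m` is eventually below any fixed multiple of `ε_m²`.

For the barycenter, minimality is tested against the Dirac mass at `w₀*`; this costs a factor four
over the average subset risk (`IsBarycenter.lintegral_sq_le`). -/

/-! ### Gaussian laws tilted by a quadratic exponent. -/

section GaussianTilt

variable {E : Type*} [NormedAddCommGroup E] [InnerProductSpace ℝ E] [FiniteDimensional ℝ E]
  [MeasurableSpace E] [BorelSpace E]

/-- The standard Gaussian law has a Lebesgue density proportional to `exp (-‖z‖² / 2)`. -/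
lemma exists_stdGaussian_eq_smul_withDensity :
    ∃ κ : ℝ≥0∞, stdGaussian E =
      κ • (volume : Measure E).withDensity
        (fun z => ENNReal.ofReal (Real.exp (-(1 / 2) * ‖z‖ ^ 2))) := by
  set Z : ℝ := (Real.pi / (1 / 2)) ^ (Module.finrank ℝ E / 2 : ℝ) with hZ
  have hZpos : 0 < Z := by positivity
  have hmeas : Measurable (fun z : E => ENNReal.ofReal (Real.exp (-(1 / 2) * ‖z‖ ^ 2))) := by
    fun_prop
  have hint : Integrable (fun z : E => Real.exp (-(1 / 2) * ‖z‖ ^ 2)) := by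
    apply Integrable.of_integral_ne_zero
    rw [GaussianFourier.integral_rexp_neg_mul_sq_norm (by norm_num)]
    exact hZpos.ne'
  have hmass : ∫⁻ z : E, ENNReal.ofReal (Real.exp (-(1 / 2) * ‖z‖ ^ 2)) = ENNReal.ofReal Z := by
    rw [← ofReal_integral_eq_lintegral_ofReal hint (ae_of_all _ fun z => (Real.exp_pos _).le),
      GaussianFourier.integral_rexp_neg_mul_sq_norm (by norm_num)]
  refine ⟨ENNReal.ofReal Z⁻¹, ?_⟩
  have hfin : IsFiniteMeasure ((volume : Measure E).withDensity
      (fun z => ENNReal.ofReal (Real.exp (-(1 / 2) * ‖z‖ ^ 2)))) :=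
    isFiniteMeasure_withDensity (by rw [hmass]; exact ENNReal.ofReal_ne_top)
  have hfin' : IsFiniteMeasure (ENNReal.ofReal Z⁻¹ • (volume : Measure E).withDensity
      (fun z => ENNReal.ofReal (Real.exp (-(1 / 2) * ‖z‖ ^ 2)))) :=
    Measure.smul_finite _ ENNReal.ofReal_ne_top
  -- Both measures are finite, so it suffices to compare characteristic functions; on the right this
  -- is the Gaussian Fourier integral.
  apply Measure.ext_of_charFun
  ext t
  rw [charFun_stdGaussian, charFun_apply, integral_smul_measure,
    integral_withDensity_eq_integral_toReal_smul hmeas (ae_of_all _ fun _ => ENNReal.ofReal_lt_top)]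
  have h := GaussianFourier.integral_cexp_neg_mul_sq_norm_add (V := E) (b := 1 / 2) (by norm_num)
    Complex.I t
  have hI : ∫ x : E, (ENNReal.ofReal (Real.exp (-(1 / 2) * ‖x‖ ^ 2))).toReal •
      Complex.exp (inner ℝ x t * Complex.I) =
      ∫ v : E, Complex.exp (-(1 / 2) * ‖v‖ ^ 2 + Complex.I * inner ℝ t v) := by
    congr 1
    ext x
    rw [ENNReal.toReal_ofReal (Real.exp_pos _).le, Complex.real_smul, Complex.exp_add,
      real_inner_comm]
    push_cast
    ring_nf
  rw [hI, h]
  have hZc : ((Real.pi : ℂ) / (1 / 2)) ^ (Module.finrank ℝ E / 2 : ℂ) = (Z : ℂ) := by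
    rw [hZ, Complex.ofReal_cpow (by positivity)]
    push_cast
    rfl
  rw [hZc, ENNReal.toReal_ofReal (by positivity), Complex.real_smul, Complex.ofReal_inv,
    ← mul_assoc, inv_mul_cancel₀ (by exact_mod_cast hZpos.ne'), one_mul, Complex.I_sq]
  congr 1
  ring

/-- Moments of `exp (-q / 2)` for a nonnegative function `q` that is homogeneous of degree two. -/
lemma lintegral_homogeneous_mul_exp_le {q : E → ℝ} (hq : Measurable q) (hq0 : ∀ v, 0 ≤ q v)
    (hqs : ∀ (s : ℝ) v, q (s • v) = s ^ 2 * q v) :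
    ∫⁻ v, ENNReal.ofReal (q v) * ENNReal.ofReal (Real.exp (-(1 / 2) * q v)) ≤
      ENNReal.ofReal (4 * √2 ^ Module.finrank ℝ E) *
        ∫⁻ v, ENNReal.ofReal (Real.exp (-(1 / 2) * q v)) := by
  have hs : (√2)⁻¹ ≠ 0 := by positivity
  -- Half of the exponent absorbs the factor `q`, by `q ≤ 4 exp (q / 4)`. Dilation by `1 / √2`
  -- restores the other half to the full exponent, with Jacobian `√2 ^ dim`.
  have key : ∫⁻ v, ENNReal.ofReal (Real.exp (-(1 / 4) * q v)) =
      ENNReal.ofReal (√2 ^ Module.finrank ℝ E) *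
        ∫⁻ v, ENNReal.ofReal (Real.exp (-(1 / 2) * q v)) := by
    have h1 : ∀ v, Real.exp (-(1 / 4) * q v) = Real.exp (-(1 / 2) * q ((√2)⁻¹ • v)) := by
      intro v
      rw [hqs, inv_pow, Real.sq_sqrt (by norm_num)]
      ring_nf
    simp_rw [h1]
    rw [← lintegral_map (f := fun v => ENNReal.ofReal (Real.exp (-(1 / 2) * q v)))
      (by fun_prop) (measurable_const_smul (√2)⁻¹), Measure.map_addHaar_smul _ hs,
      lintegral_smul_measure, inv_pow, inv_inv, abs_of_nonneg (by positivity), smul_eq_mul]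
  calc ∫⁻ v, ENNReal.ofReal (q v) * ENNReal.ofReal (Real.exp (-(1 / 2) * q v))
      ≤ ∫⁻ v, ENNReal.ofReal 4 * ENNReal.ofReal (Real.exp (-(1 / 4) * q v)) := by
        refine lintegral_mono fun v => ?_
        rw [← ENNReal.ofReal_mul (hq0 v), ← ENNReal.ofReal_mul (by norm_num)]
        apply ENNReal.ofReal_le_ofReal
        have h2 : q v ≤ 4 * Real.exp (1 / 4 * q v) := by
          have := Real.add_one_le_exp (1 / 4 * q v)
          linarith
        calc q v * Real.exp (-(1 / 2) * q v)
            ≤ 4 * Real.exp (1 / 4 * q v) * Real.exp (-(1 / 2) * q v) := by gcongr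
          _ = 4 * Real.exp (-(1 / 4) * q v) := by
            rw [mul_assoc, ← Real.exp_add]
            ring_nf
    _ = ENNReal.ofReal (4 * √2 ^ Module.finrank ℝ E) *
        ∫⁻ v, ENNReal.ofReal (Real.exp (-(1 / 2) * q v)) := by
        rw [lintegral_const_mul _ (by fun_prop), key, ENNReal.ofReal_mul (by norm_num), mul_assoc]

/-- Second moments about `θ₀` of the law with density proportional to
`exp (-(⟪G u, u⟫ - 2 ⟪u, g⟫) / 2)`, where `u = θ - θ₀`, relative to a centred Gaussian law with
covariance operator `T * T`. -/
lemma lintegral_sq_mul_gaussian_tilt_le {T G : E →L[ℝ] E} {θ₀ p₀ g : E} {lam : ℝ}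
    (hT : ∀ u v, inner ℝ (T u) v = inner ℝ u (T v))
    (hG : ∀ u v, inner ℝ (G u) v = inner ℝ u (G v))
    (hlam : 0 < lam) (hGlam : ∀ u, lam * ‖u‖ ^ 2 ≤ inner ℝ (G u) u) (hp₀ : T (T p₀) = θ₀) :
    ∫⁻ θ, ‖θ - θ₀‖ₑ ^ 2 * ENNReal.ofReal
        (Real.exp (-(1 / 2) * (inner ℝ (G (θ - θ₀)) (θ - θ₀) - 2 * inner ℝ (θ - θ₀) g)))
        ∂(stdGaussian E).map T ≤
      ENNReal.ofReal (2 * (‖g - p₀‖ / lam) ^ 2 + 8 * √2 ^ Module.finrank ℝ E / lam) *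
      ∫⁻ θ, ENNReal.ofReal
        (Real.exp (-(1 / 2) * (inner ℝ (G (θ - θ₀)) (θ - θ₀) - 2 * inner ℝ (θ - θ₀) g)))
        ∂(stdGaussian E).map T := by
  -- With `θ = T z` and `z` standard Gaussian, `q` is the quadratic part of the total exponent in
  -- `z`. The linear part will be removed by the shift `z = v + (m + T p₀)`.
  set q : E → ℝ := fun v => inner ℝ (G (T v)) (T v) + ‖v‖ ^ 2 with hq
  have hqmeas : Measurable q := by
    have : Continuous q := by fun_prop
    exact this.measurable
  have hq0 : ∀ v, 0 ≤ q v := fun v => by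
    have := hGlam (T v)
    have : 0 ≤ lam * ‖T v‖ ^ 2 := by positivity
    simp only [hq]
    nlinarith [sq_nonneg ‖v‖]
  have hqs : ∀ (s : ℝ) v, q (s • v) = s ^ 2 * q v := fun s v => by
    simp only [hq, map_smul, inner_smul_left, inner_smul_right, norm_smul, Real.norm_eq_abs,
      mul_pow, sq_abs, conj_trivial]
    ring
  have hqT : ∀ v, lam * ‖T v‖ ^ 2 ≤ q v := fun v => by
    have := hGlam (T v)
    simp only [hq]
    nlinarith [sq_nonneg ‖v‖]
  -- the centre of the tilted law
  obtain ⟨m, hm⟩ : ∃ m, T (G (T m)) + m = T (g - p₀) := by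
    have hinj : Function.Injective
        (((T ∘L G ∘L T) + ContinuousLinearMap.id ℝ E : E →L[ℝ] E) : E →ₗ[ℝ] E) := by
      rw [← LinearMap.ker_eq_bot, LinearMap.ker_eq_bot']
      intro v hv
      have hv' : T (G (T v)) + v = 0 := by simpa using hv
      have h0 : q v = 0 := by
        have : inner ℝ (T (G (T v)) + v) v = q v := by
          rw [inner_add_left, hT, real_inner_self_eq_norm_sq]
        rw [← this, hv', inner_zero_left]
      have h1 := hGlam (T v)
      have h2 : 0 ≤ lam * ‖T v‖ ^ 2 := by positivity
      have h3 : ‖v‖ ^ 2 = 0 := by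
        simp only [hq] at h0
        nlinarith [sq_nonneg ‖v‖]
      simpa using h3
    obtain ⟨m, hm⟩ := LinearMap.injective_iff_surjective.1 hinj (T (g - p₀))
    exact ⟨m, by simpa using hm⟩
  -- Pairing the equation of `m` with `m` gives `q m = ⟪T m, g - p₀⟫`; coercivity of `G` and
  -- Cauchy–Schwarz bound the bias `T m`.
  have hTm : ‖T m‖ ≤ ‖g - p₀‖ / lam := by
    have h1 : q m = inner ℝ (T m) (g - p₀) := by
      have : inner ℝ (T (G (T m)) + m) m = q m := by
        rw [inner_add_left, hT, real_inner_self_eq_norm_sq]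
      rw [← this, hm, hT, real_inner_comm]
    have h2 := hqT m
    have h3 := real_inner_le_norm (T m) (g - p₀)
    rw [le_div_iff₀ hlam]
    rcases (norm_nonneg (T m)).eq_or_lt with h0 | h0
    · rw [← h0, zero_mul]
      positivity
    · nlinarith
  obtain ⟨κ, hκ⟩ := exists_stdGaussian_eq_smul_withDensity (E := E)
  have hF : Continuous fun θ : E => Real.exp (-(1 / 2) *
      (inner ℝ (G (θ - θ₀)) (θ - θ₀) - 2 * inner ℝ (θ - θ₀) g)) := by fun_prop
  set c : ℝ := Real.exp (1 / 2 * q m - 1 / 2 * ‖T p₀‖ ^ 2) with hc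
  -- completing the square
  have hsq : ∀ v : E, Real.exp (-(1 / 2) * (inner ℝ (G (T (v + (m + T p₀)) - θ₀))
      (T (v + (m + T p₀)) - θ₀) - 2 * inner ℝ (T (v + (m + T p₀)) - θ₀) g)) *
      Real.exp (-(1 / 2) * ‖v + (m + T p₀)‖ ^ 2) = c * Real.exp (-(1 / 2) * q v) := by
    intro v
    have hu : T (v + (m + T p₀)) - θ₀ = T v + T m := by
      rw [← hp₀]
      simp only [map_add]
      abel
    rw [hu, hc, ← Real.exp_add, ← Real.exp_add]
    congr 1
    have e1 : inner ℝ (G (T m)) (T v) + inner ℝ m v = inner ℝ (T v) g - inner ℝ v (T p₀) := by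
      have : inner ℝ (T (G (T m)) + m) v = inner ℝ (T (g - p₀)) v := by rw [hm]
      rw [inner_add_left, hT, hT, inner_sub_left, ← hT p₀ v, real_inner_comm v (T p₀),
        real_inner_comm (T v) g] at this
      linarith
    have e2 : inner ℝ (G (T m)) (T m) + inner ℝ m m = inner ℝ (T m) g - inner ℝ m (T p₀) := by
      have : inner ℝ (T (G (T m)) + m) m = inner ℝ (T (g - p₀)) m := by rw [hm]
      rw [inner_add_left, hT, hT, inner_sub_left, ← hT p₀ m, real_inner_comm m (T p₀),
        real_inner_comm (T m) g] at this
      linarith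
    have e3 : inner ℝ (G (T v)) (T m) = inner ℝ (G (T m)) (T v) := by
      rw [hG, real_inner_comm]
    have e4 : inner ℝ (T p₀) v = inner ℝ v (T p₀) := real_inner_comm _ _
    have e5 : inner ℝ (T p₀) m = inner ℝ m (T p₀) := real_inner_comm _ _
    have e6 : inner ℝ v m = inner ℝ m v := real_inner_comm _ _
    simp only [hq, map_add, inner_add_left, inner_add_right, ← real_inner_self_eq_norm_sq]
    rw [e3, e4, e5, e6]
    linarith
  have hc0 : 0 ≤ c := (Real.exp_pos _).le
  have hmapT : Measurable T := T.continuous.measurable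
  have hdens : Measurable fun z : E => ENNReal.ofReal (Real.exp (-(1 / 2) * ‖z‖ ^ 2)) := by
    fun_prop
  -- The prefactor `κ * c` does not depend on `φ`, so it is common to both sides of the claim and
  -- never has to be evaluated.
  have hrep : ∀ φ : E → ℝ≥0∞, Measurable φ →
      ∫⁻ θ, φ θ * ENNReal.ofReal (Real.exp (-(1 / 2) * (inner ℝ (G (θ - θ₀)) (θ - θ₀)
        - 2 * inner ℝ (θ - θ₀) g))) ∂(stdGaussian E).map T =
      κ * (ENNReal.ofReal c *
        ∫⁻ v, φ (T v + T m + θ₀) * ENNReal.ofReal (Real.exp (-(1 / 2) * q v))) := by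
    intro φ hφ
    have hφF : Measurable fun θ : E => φ θ * ENNReal.ofReal (Real.exp (-(1 / 2) *
        (inner ℝ (G (θ - θ₀)) (θ - θ₀) - 2 * inner ℝ (θ - θ₀) g))) :=
      hφ.mul hF.measurable.ennreal_ofReal
    have hw := lintegral_withDensity_eq_lintegral_mul volume hdens (hφF.comp hmapT)
    simp only [Function.comp_def] at hw
    rw [lintegral_map hφF hmapT, hκ, lintegral_smul_measure, hw, smul_eq_mul,
      ← lintegral_add_right_eq_self _ (m + T p₀),
      ← lintegral_const_mul (ENNReal.ofReal c)]
    · congr 1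
      refine lintegral_congr fun v => ?_
      have hu : T (v + (m + T p₀)) = T v + T m + θ₀ := by
        rw [← hp₀]
        simp only [map_add]
        abel
      simp only [Pi.mul_apply]
      have := congrArg ENNReal.ofReal (hsq v)
      rw [ENNReal.ofReal_mul (Real.exp_pos _).le, ENNReal.ofReal_mul hc0] at this
      rw [mul_left_comm (ENNReal.ofReal c), ← this, hu]
      ring
    · exact Measurable.mul (hφ.comp (by fun_prop)) (by fun_prop)
  have h1 := hrep (fun θ => ‖θ - θ₀‖ₑ ^ 2) (by fun_prop)
  have h2 := hrep (fun _ => 1) measurable_const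
  simp only [one_mul] at h2
  rw [h1, h2, ← mul_left_comm κ]
  refine mul_le_mul_right ?_ _
  rw [← mul_left_comm (ENNReal.ofReal c)]
  refine mul_le_mul_right ?_ _
  -- Squared bias plus fluctuation: `T m` is bounded by `hTm`, and `lam * ‖T v‖²` by `q v`.
  have hpt : ∀ v, ‖T v + T m + θ₀ - θ₀‖ₑ ^ 2 ≤
      ENNReal.ofReal (2 * (‖g - p₀‖ / lam) ^ 2) + ENNReal.ofReal (2 / lam) * ENNReal.ofReal (q v) := by
    intro v
    rw [← ofReal_norm, ← ENNReal.ofReal_pow (norm_nonneg _),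
      ← ENNReal.ofReal_mul (by positivity), ← ENNReal.ofReal_add (by positivity)
        (mul_nonneg (by positivity) (hq0 v))]
    apply ENNReal.ofReal_le_ofReal
    rw [add_sub_cancel_right]
    have a1 : ‖T v + T m‖ ^ 2 ≤ 2 * ‖T m‖ ^ 2 + 2 * ‖T v‖ ^ 2 := by
      have := norm_add_le (T v) (T m)
      nlinarith [sq_nonneg (‖T v‖ - ‖T m‖), norm_nonneg (T v + T m)]
    have a2 : ‖T m‖ ^ 2 ≤ (‖g - p₀‖ / lam) ^ 2 := by gcongr
    have a3 : 2 * ‖T v‖ ^ 2 ≤ 2 / lam * q v := by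
      rw [div_mul_eq_mul_div, le_div_iff₀ hlam]
      nlinarith [hqT v]
    linarith
  have hqe : Measurable fun v => ENNReal.ofReal (Real.exp (-(1 / 2) * q v)) := by fun_prop
  calc ∫⁻ v, ‖T v + T m + θ₀ - θ₀‖ₑ ^ 2 * ENNReal.ofReal (Real.exp (-(1 / 2) * q v))
      ≤ ∫⁻ v, (ENNReal.ofReal (2 * (‖g - p₀‖ / lam) ^ 2) *
            ENNReal.ofReal (Real.exp (-(1 / 2) * q v)) + ENNReal.ofReal (2 / lam) *
            (ENNReal.ofReal (q v) * ENNReal.ofReal (Real.exp (-(1 / 2) * q v)))) := by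
        refine lintegral_mono fun v => ?_
        rw [← mul_assoc, ← add_mul]
        gcongr
        exact hpt v
    _ = ENNReal.ofReal (2 * (‖g - p₀‖ / lam) ^ 2) *
            (∫⁻ v, ENNReal.ofReal (Real.exp (-(1 / 2) * q v))) + ENNReal.ofReal (2 / lam) *
            ∫⁻ v, ENNReal.ofReal (q v) * ENNReal.ofReal (Real.exp (-(1 / 2) * q v)) := by
        rw [lintegral_add_left (by fun_prop), lintegral_const_mul _ hqe,
          lintegral_const_mul _ (by fun_prop)]
    _ ≤ ENNReal.ofReal (2 * (‖g - p₀‖ / lam) ^ 2) *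
            (∫⁻ v, ENNReal.ofReal (Real.exp (-(1 / 2) * q v))) + ENNReal.ofReal (2 / lam) *
            (ENNReal.ofReal (4 * √2 ^ Module.finrank ℝ E) *
              ∫⁻ v, ENNReal.ofReal (Real.exp (-(1 / 2) * q v))) := by
        gcongr
        exact lintegral_homogeneous_mul_exp_le hqmeas hq0 hqs
    _ = _ := by
        rw [← mul_assoc, ← add_mul, ← ENNReal.ofReal_mul (by positivity),
          ← ENNReal.ofReal_add (by positivity) (by positivity)]
        congr 3
        ring

end GaussianTilt

/-! ### Finite-dimensional Gaussian vectors. -/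

section MultivariateGaussian

variable {ι : Type*} [Fintype ι]

lemma quadraticForm_eq_covarianceBilin {Ω : Type*} {mΩ : MeasurableSpace Ω} {P : Measure Ω}
    [IsFiniteMeasure P] {X : ι → Ω → ℝ} {S : Matrix ι ι ℝ} (hX : ∀ i, MemLp (X i) 2 P)
    (hS : ∀ i j, cov[X i, X j; P] = S i j) (b : ι → ℝ) :
    covarianceBilin (P.map (fun ω ↦ WithLp.toLp 2 (X · ω))) (WithLp.toLp 2 b) (WithLp.toLp 2 b) =
      b ⬝ᵥ S *ᵥ b := by
  rw [covarianceBilin_apply_pi hX]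
  simp only [hS, dotProduct, Matrix.mulVec, Finset.mul_sum]
  refine Finset.sum_congr rfl fun i _ => Finset.sum_congr rfl fun j _ => ?_
  ring

lemma posSemidef_of_covariance_eq {Ω : Type*} {mΩ : MeasurableSpace Ω} {P : Measure Ω}
    [IsFiniteMeasure P] {X : ι → Ω → ℝ} {S : Matrix ι ι ℝ} (hX : ∀ i, MemLp (X i) 2 P)
    (hS : ∀ i j, cov[X i, X j; P] = S i j) : S.PosSemidef := by
  refine Matrix.PosSemidef.of_dotProduct_mulVec_nonneg ?_ fun b => ?_
  · ext i j
    rw [Matrix.conjTranspose_apply, star_trivial, ← hS, ← hS, covariance_comm]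
  · rw [star_trivial, ← quadraticForm_eq_covarianceBilin hX hS]
    exact covarianceBilin_self_nonneg _

/-- A Gaussian vector has the multivariate Gaussian law given by its means and covariances. -/
lemma map_eq_multivariateGaussian [DecidableEq ι] {Ω : Type*} {mΩ : MeasurableSpace Ω}
    {P : Measure Ω} {X : ι → Ω → ℝ} {μ : EuclideanSpace ℝ ι} {S : Matrix ι ι ℝ}
    (hX : HasGaussianLaw (fun ω ↦ (X · ω)) P) (hμ : ∀ i, ∫ ω, X i ω ∂P = μ i)
    (hS : ∀ i j, cov[X i, X j; P] = S i j) :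
    P.map (fun ω ↦ WithLp.toLp 2 (X · ω)) = multivariateGaussian μ S := by
  have hP := hX.isProbabilityMeasure
  have hXi : ∀ i, MemLp (X i) 2 P := fun i =>
    (hX.map (ContinuousLinearMap.proj (R := ℝ) i)).memLp_two
  have hXm : ∀ i, AEMeasurable (X i) P := fun i => (hXi i).aemeasurable
  have hpsd := posSemidef_of_covariance_eq hXi hS
  have hL := hX.toLp_pi 2
  have hg := hL.isGaussian_map
  refine IsGaussian.ext ?_ ?_
  · rw [integral_id_multivariateGaussian', integral_map (by fun_prop) (by fun_prop)]
    ext i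
    have := (EuclideanSpace.proj (𝕜 := ℝ) i).integral_comp_comm hL.integrable
    simp only [id_eq]
    rw [← hμ]
    simpa using this.symm
  · rw [← ContinuousLinearMap.toBilinForm_inj]
    refine LinearMap.BilinForm.ext_basis (EuclideanSpace.basisFun ι ℝ).toBasis fun i j ↦ ?_
    simp only [ContinuousLinearMap.toBilinForm_apply, OrthonormalBasis.coe_toBasis]
    rw [covarianceBilin_apply_basisFun hXi, hS, covarianceBilin_multivariateGaussian hpsd]
    simp

/-- The coordinates of a multivariate Gaussian vector picked out by `f` are Gaussian. -/
lemma map_reindex_multivariateGaussian [DecidableEq ι] {κ : Type*} [Fintype κ] [DecidableEq κ]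
    {μ : EuclideanSpace ℝ ι} {S : Matrix ι ι ℝ} (hS : S.PosSemidef) (f : κ → ι) :
    (multivariateGaussian μ S).map (fun y => WithLp.toLp 2 (fun i => y (f i))) =
      multivariateGaussian (WithLp.toLp 2 (fun i => μ (f i))) (S.submatrix f f) := by
  refine map_eq_multivariateGaussian (X := fun i (y : EuclideanSpace ℝ ι) => y (f i)) ?_ (fun i => ?_) (fun i j => ?_)
  · have h := IsGaussian.hasGaussianLaw_id (μ := multivariateGaussian μ S)
    exact h.map (ContinuousLinearMap.pi fun i => EuclideanSpace.proj (𝕜 := ℝ) (f i))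
  · have := (EuclideanSpace.proj (𝕜 := ℝ) (f i)).integral_comp_comm
      (IsGaussian.integrable_fun_id (μ := multivariateGaussian μ S))
    rw [integral_id_multivariateGaussian] at this
    simpa using this
  · exact covariance_eval_multivariateGaussian hS (f i) (f j)

/-- Each coordinate contributes the variance of a linear functional, a diagonal entry of `B * S *
Bᵀ`. It serves to compute the mean square of the score. -/
lemma lintegral_sq_norm_mulVec_multivariateGaussian [DecidableEq ι] {κ : Type*} [Fintype κ]
    {μ : EuclideanSpace ℝ ι} {S : Matrix ι ι ℝ} (hS : S.PosSemidef) (B : Matrix κ ι ℝ) :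
    ∫⁻ y, ENNReal.ofReal (‖(WithLp.toLp 2 (B *ᵥ (y - μ).ofLp) : EuclideanSpace ℝ κ)‖ ^ 2)
      ∂multivariateGaussian μ S = ENNReal.ofReal (B * S * Bᵀ).trace := by
  have hrow : ∀ a, ∫⁻ y, ENNReal.ofReal ((B *ᵥ (y - μ).ofLp) a ^ 2) ∂multivariateGaussian μ S =
      ENNReal.ofReal (B a ⬝ᵥ S *ᵥ B a) := by
    intro a
    have hid := IsGaussian.memLp_two_id (μ := multivariateGaussian μ S)
    have hL : ∀ y : EuclideanSpace ℝ ι, inner ℝ (WithLp.toLp 2 (B a)) y = B a ⬝ᵥ y.ofLp := by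
      intro y
      simp [PiLp.inner_apply, dotProduct, mul_comm]
    have hmem : MemLp (fun y => inner ℝ (WithLp.toLp 2 (B a)) y) 2 (multivariateGaussian μ S) :=
      hid.const_inner _
    have h1 : ∫ y, inner ℝ (WithLp.toLp 2 (B a)) y ∂multivariateGaussian μ S =
        inner ℝ (WithLp.toLp 2 (B a)) μ := by
      rw [integral_inner IsGaussian.integrable_fun_id, integral_id_multivariateGaussian]
    have h2 : covarianceBilin (multivariateGaussian μ S) (WithLp.toLp 2 (B a))
        (WithLp.toLp 2 (B a)) = Var[fun y => inner ℝ (WithLp.toLp 2 (B a)) y;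
          multivariateGaussian μ S] := covarianceBilin_self hid _
    rw [covarianceBilin_multivariateGaussian hS] at h2
    rw [h2, hmem.ofReal_variance_eq, evariance_eq_lintegral_ofReal, h1]
    refine lintegral_congr fun y => ?_
    rw [hL, hL, ← dotProduct_sub]
    rfl
  have hmeas : ∀ a, Measurable fun y : EuclideanSpace ℝ ι =>
      ENNReal.ofReal ((B *ᵥ (y - μ).ofLp) a ^ 2) := by
    intro a
    simp only [Matrix.mulVec, dotProduct]
    fun_prop
  simp_rw [EuclideanSpace.real_norm_sq_eq]
  have h3 : ∀ y : EuclideanSpace ℝ ι, ENNReal.ofReal (∑ a, (B *ᵥ (y - μ).ofLp) a ^ 2) =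
      ∑ a, ENNReal.ofReal ((B *ᵥ (y - μ).ofLp) a ^ 2) := fun y =>
    ENNReal.ofReal_sum_of_nonneg fun a _ => sq_nonneg _
  simp_rw [h3]
  rw [lintegral_finsetSum _ fun a _ => hmeas a]
  simp_rw [hrow]
  rw [← ENNReal.ofReal_sum_of_nonneg fun a _ => by simpa using hS.dotProduct_mulVec_nonneg (B a)]
  congr 1
  simp only [Matrix.trace, Matrix.diag_apply]
  refine Finset.sum_congr rfl fun a _ => ?_
  rw [Matrix.mul_assoc, Matrix.mul_apply, dotProduct]
  refine Finset.sum_congr rfl fun i _ => ?_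
  rfl

end MultivariateGaussian

/-! ### The Gaussian process prior and the data law at finitely many locations. -/

namespace DISK

section Prior

variable {D : Type*} {C : D → D → ℝ} {P : Measure (D → ℝ)} {ι κ : Type*} {l : ℕ}

lemma measurable_evalAt [Fintype ι] (x : ι → D) : Measurable (evalAt x) := by
  unfold evalAt
  fun_prop

lemma IsGPPrior.hasGaussianLaw [Fintype ι] (hP : IsGPPrior C P) (z : ι → D) :
    HasGaussianLaw (fun w i => w (z i)) P := by
  classical
  have h := (hP.gaussian.comp_right z).hasGaussianLaw Finset.univ
  exact h.map (ContinuousLinearMap.pi fun i =>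
    ContinuousLinearMap.proj (R := ℝ) (⟨i, Finset.mem_univ i⟩ : (Finset.univ : Finset ι)))

lemma IsGPPrior.posSemidef_covMatrix [Fintype ι] (hP : IsGPPrior C P) (z : ι → D) :
    (covMatrix C z z).PosSemidef := by
  have := hP.gaussian.isProbabilityMeasure
  refine posSemidef_of_covariance_eq (P := P) (X := fun i (w : D → ℝ) => w (z i))
    (fun i => (hP.gaussian.hasGaussianLaw_eval (z i)).memLp_two) fun i j => ?_
  rw [hP.cov]
  rfl

lemma IsGPPrior.map_evalAt [Fintype ι] [DecidableEq ι] (hP : IsGPPrior C P) (z : ι → D) :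
    P.map (evalAt z) = multivariateGaussian 0 (covMatrix C z z) :=
  map_eq_multivariateGaussian (X := fun i (w : D → ℝ) => w (z i)) (hP.hasGaussianLaw z)
    (fun i => by rw [hP.mean_zero]; rfl) (fun i j => by rw [hP.cov]; rfl)

/-- Without the noise term this is the Schur complement of `C_{*,*}` in the joint covariance matrix
of the observed and test locations, hence positive semidefinite. -/
lemma IsGPPrior.posDef_condCov [Fintype ι] [DecidableEq ι] (hP : IsGPPrior C P) {t : Fin l → D}
    (ht : (covMatrix C t t).PosDef) {v : ℝ} (hv : 0 < v) (x : ι → D) :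
    (condCov C v t x).PosDef := by
  have hsymm : ∀ a b, C a b = C b a := fun a b => by rw [← hP.cov, ← hP.cov, covariance_comm]
  have hjoint := hP.posSemidef_covMatrix (Sum.elim x t)
  have hblock : covMatrix C (Sum.elim x t) (Sum.elim x t) =
      Matrix.fromBlocks (covMatrix C x x) (covMatrix C t x)ᵀ ((covMatrix C t x)ᵀ)ᴴ
        (covMatrix C t t) := by
    ext (i | i) (j | j) <;> simp [covMatrix, hsymm (x _) (t _)]
  have := ht.isUnit.invertible
  rw [hblock, Matrix.PosDef.fromBlocks₂₂ _ _ ht] at hjoint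
  have h1 : (v • (1 : Matrix ι ι ℝ)).PosDef := Matrix.PosDef.one.smul hv
  have h2 := h1.add_posSemidef hjoint
  have h3 : condCov C v t x = v • (1 : Matrix ι ι ℝ) + (covMatrix C x x - (covMatrix C t x)ᵀ *
      (covMatrix C t t)⁻¹ * ((covMatrix C t x)ᵀ)ᴴ) := by
    simp [condCov, Matrix.conjTranspose_eq_transpose_of_trivial, add_sub_assoc]
  rw [h3]
  exact h2

lemma measurable_subsetData {k m : ℕ} (j : Fin k) :
    Measurable fun y : EuclideanSpace ℝ (Fin k × Fin m) => subsetData y j := by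
  unfold subsetData
  fun_prop

/-- The law of a data subset under the law of the full data. -/
lemma map_subsetData_dataLaw {k m : ℕ} {v : ℝ} {t : Fin l → D} {x : Fin k → Fin m → D}
    (hS : (condCov C v t (fullLoc x)).PosDef) (b : EuclideanSpace ℝ (Fin l)) (j : Fin k) :
    (dataLaw C v t (fullLoc x) b).map (fun y => subsetData y j) = dataLaw C v t (x j) b := by
  have h := map_reindex_multivariateGaussian (μ := dataMean C t (fullLoc x) b) hS.posSemidef
    (fun i : Fin m => (j, i))
  unfold dataLaw subsetData
  rw [h]
  -- Each entry of `Σ` involves only its own two observed locations, so the diagonal block of the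
  -- full `Σ` is `Σ_j`.
  congr 1
  ext i i'
  simp [condCov, covMatrix, fullLoc, Matrix.one_apply, Matrix.mul_apply]

end Prior

end DISK

/-! ### The posterior of the test values and its risk. -/

namespace DISK

section Posterior

variable {D : Type*} {C : D → D → ℝ} {P : Measure (D → ℝ)} {ι : Type*} [Fintype ι]
  [DecidableEq ι] {l : ℕ} {t : Fin l → D} {x : ι → D} {v : ℝ}

/-- The information matrix `Aᵀ Σ⁻¹ A` of the data at the locations `x` about the test values. -/
noncomputable def infoMatrix (C : D → D → ℝ) (v : ℝ) (t : Fin l → D) (x : ι → D) :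
    Matrix (Fin l) (Fin l) ℝ :=
  (regMatrix C t x)ᵀ * (condCov C v t x)⁻¹ * regMatrix C t x

/-- The score `Aᵀ Σ⁻¹ (y - A b)` at the test values `b`. -/
noncomputable def score (C : D → D → ℝ) (v : ℝ) (t : Fin l → D) (x : ι → D)
    (b : EuclideanSpace ℝ (Fin l)) (y : EuclideanSpace ℝ ι) : EuclideanSpace ℝ (Fin l) :=
  WithLp.toLp 2 (((regMatrix C t x)ᵀ * (condCov C v t x)⁻¹) *ᵥ (y - dataMean C t x b).ofLp)

lemma transpose_inv_condCov (hS : (condCov C v t x).PosDef) :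
    ((condCov C v t x)⁻¹)ᵀ = (condCov C v t x)⁻¹ := by
  have := hS.inv.isHermitian
  rwa [Matrix.IsHermitian, Matrix.conjTranspose_eq_transpose_of_trivial] at this

lemma transpose_infoMatrix (hS : (condCov C v t x).PosDef) :
    (infoMatrix C v t x)ᵀ = infoMatrix C v t x := by
  simp [infoMatrix, Matrix.transpose_mul, transpose_inv_condCov hS, Matrix.mul_assoc]

lemma dotProduct_infoMatrix_mulVec (b b' : Fin l → ℝ) :
    b ⬝ᵥ infoMatrix C v t x *ᵥ b' =
      (regMatrix C t x *ᵥ b) ⬝ᵥ ((condCov C v t x)⁻¹ *ᵥ (regMatrix C t x *ᵥ b')) := by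
  rw [infoMatrix, ← Matrix.mulVec_mulVec, ← Matrix.mulVec_mulVec, Matrix.dotProduct_mulVec,
    Matrix.vecMul_transpose]

lemma dataNorm_nonneg (b : EuclideanSpace ℝ (Fin l)) : 0 ≤ dataNorm C v t x b :=
  Real.sqrt_nonneg _

lemma dataNorm_sq (hS : (condCov C v t x).PosDef) (b : EuclideanSpace ℝ (Fin l)) :
    dataNorm C v t x b ^ 2 =
      1 / (Fintype.card ι : ℝ) * (b.ofLp ⬝ᵥ infoMatrix C v t x *ᵥ b.ofLp) := by
  rw [dataNorm, Real.sq_sqrt, dotProduct_infoMatrix_mulVec]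
  have := hS.inv.posSemidef.dotProduct_mulVec_nonneg (regMatrix C t x *ᵥ b.ofLp)
  rw [star_trivial] at this
  positivity

lemma gaussianDensity_pos {S : Matrix ι ι ℝ} (hS : S.PosDef) (μ y : EuclideanSpace ℝ ι) :
    0 < gaussianDensity μ S y := by
  have := hS.det_pos
  unfold gaussianDensity
  positivity

/-- The likelihood as a function of the test values, expanded about the test values `b`. -/
lemma exists_gaussianDensity_dataMean_eq (hS : (condCov C v t x).PosDef)
    (b : EuclideanSpace ℝ (Fin l)) (y : EuclideanSpace ℝ ι) :
    ∃ c : ℝ, 0 < c ∧ ∀ θ, gaussianDensity (dataMean C t x θ) (condCov C v t x) y =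
      c * Real.exp (-(1 / 2) *
        (inner ℝ (Matrix.toEuclideanCLM (𝕜 := ℝ) (infoMatrix C v t x) (θ - b)) (θ - b)
          - 2 * inner ℝ (θ - b) (score C v t x b y))) := by
  refine ⟨gaussianDensity (dataMean C t x b) (condCov C v t x) y, gaussianDensity_pos hS _ _,
    fun θ => ?_⟩
  unfold gaussianDensity
  rw [mul_assoc, ← Real.exp_add]
  congr 2
  set A := regMatrix C t x with hA
  set Q := (condCov C v t x)⁻¹ with hQ
  have hQt : Qᵀ = Q := transpose_inv_condCov hS
  set e : ι → ℝ := (y - dataMean C t x b).ofLp with he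
  set u : Fin l → ℝ := (θ - b).ofLp with hu
  have h1 : (y - dataMean C t x θ).ofLp = e - A *ᵥ u := by
    simp only [he, hu, dataMean, WithLp.ofLp_sub, Matrix.mulVec_sub]
    abel
  have h2 : inner ℝ (Matrix.toEuclideanCLM (𝕜 := ℝ) (infoMatrix C v t x) (θ - b)) (θ - b) =
      (A *ᵥ u) ⬝ᵥ (Q *ᵥ (A *ᵥ u)) := by
    rw [real_inner_comm, Matrix.inner_toEuclideanCLM, dotProduct_infoMatrix_mulVec]
  have h3 : inner ℝ (θ - b) (score C v t x b y) = (A *ᵥ u) ⬝ᵥ (Q *ᵥ e) := by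
    have : inner ℝ (θ - b) (score C v t x b y) = u ⬝ᵥ (Aᵀ * Q) *ᵥ e := by
      simp [PiLp.inner_apply, dotProduct, score, mul_comm, hu, he, hA, hQ]
    rw [this, ← Matrix.mulVec_mulVec, Matrix.dotProduct_mulVec, Matrix.vecMul_transpose]
  have h4 : e ⬝ᵥ (Q *ᵥ (A *ᵥ u)) = (A *ᵥ u) ⬝ᵥ (Q *ᵥ e) := by
    rw [Matrix.dotProduct_mulVec, ← Matrix.mulVec_transpose, hQt, dotProduct_comm]
  rw [h1, h2, h3]
  simp only [Matrix.mulVec_sub, sub_dotProduct, dotProduct_sub]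
  rw [h4]
  ring

lemma continuous_score (b : EuclideanSpace ℝ (Fin l)) : Continuous (score C v t x b) := by
  unfold score
  have : Continuous fun y : EuclideanSpace ℝ ι => (y - dataMean C t x b).ofLp := by fun_prop
  fun_prop

lemma measurable_likelihood (hS : (condCov C v t x).PosDef) (y : EuclideanSpace ℝ ι) :
    Measurable (likelihood C v t x y) := by
  obtain ⟨c, -, hc⟩ := exists_gaussianDensity_dataMean_eq hS 0 y
  have h : Measurable fun θ : EuclideanSpace ℝ (Fin l) =>
      gaussianDensity (dataMean C t x θ) (condCov C v t x) y := by
    simp_rw [hc]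
    apply Continuous.measurable
    fun_prop
  exact (h.comp (measurable_evalAt t)).ennreal_ofReal

/-- Uniformity in `w` makes the evidence finite, so that Bayes' formula can be normalised. -/
lemma likelihood_le (hS : (condCov C v t x).PosDef) (y : EuclideanSpace ℝ ι) (w : D → ℝ) :
    likelihood C v t x y w ≤
      ENNReal.ofReal (Real.sqrt ((2 * Real.pi) ^ Fintype.card ι * (condCov C v t x).det))⁻¹ := by
  unfold likelihood gaussianDensity
  apply ENNReal.ofReal_le_ofReal
  refine mul_le_of_le_one_right (by positivity) (Real.exp_le_one_iff.2 ?_)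
  have := hS.inv.posSemidef.dotProduct_mulVec_nonneg (y - dataMean C t x (evalAt t w)).ofLp
  rw [star_trivial] at this
  linarith

lemma isProbabilityMeasure_posterior [IsProbabilityMeasure P] (hS : (condCov C v t x).PosDef)
    (y : EuclideanSpace ℝ ι) : IsProbabilityMeasure (posterior C v t P x y) := by
  have hm := measurable_likelihood (C := C) hS y
  constructor
  rw [posterior, Measure.smul_apply, withDensity_apply _ MeasurableSet.univ, setLIntegral_univ,
    smul_eq_mul, ENNReal.inv_mul_cancel]
  · rw [Ne, lintegral_eq_zero_iff hm]
    intro h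
    obtain ⟨w, hw⟩ := Filter.Eventually.exists (f := ae P) h
    exact (ENNReal.ofReal_pos.2 (gaussianDensity_pos hS _ y)).ne' hw
  · have h := lintegral_mono (μ := P) (likelihood_le hS y)
    rw [lintegral_const, measure_univ, mul_one] at h
    exact ne_top_of_le_ne_top ENNReal.ofReal_ne_top h

open scoped MatrixOrder in
/-- A bound on the risk of the posterior law of the test values, given the data `y`. -/
lemma lintegral_sq_posterior_le (hP : IsGPPrior C P) (ht : (covMatrix C t t).PosDef)
    (hS : (condCov C v t x).PosDef) {lam : ℝ} (hlam : 0 < lam)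
    (hG : ∀ u : EuclideanSpace ℝ (Fin l),
      lam * ‖u‖ ^ 2 ≤ u.ofLp ⬝ᵥ infoMatrix C v t x *ᵥ u.ofLp)
    (b : EuclideanSpace ℝ (Fin l)) (y : EuclideanSpace ℝ ι) :
    ∫⁻ w, ‖evalAt t w - b‖ₑ ^ 2 ∂posterior C v t P x y ≤
      ENNReal.ofReal (2 * (‖score C v t x b y -
        WithLp.toLp 2 ((covMatrix C t t)⁻¹ *ᵥ b.ofLp)‖ / lam) ^ 2 + 8 * √2 ^ l / lam) := by
  obtain ⟨c, hc0, hc⟩ := exists_gaussianDensity_dataMean_eq hS b y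
  -- The prior law of `w*` is the image of the standard Gaussian under `T = C_{*,*}^{1/2}`;
  -- accordingly `p₀ = C_{*,*}⁻¹ b`.
  set T := Matrix.toEuclideanCLM (𝕜 := ℝ) (CFC.sqrt (covMatrix C t t)) with hT
  set G := Matrix.toEuclideanCLM (𝕜 := ℝ) (infoMatrix C v t x) with hGdef
  set W : EuclideanSpace ℝ (Fin l) → ℝ≥0∞ := fun θ => ENNReal.ofReal (Real.exp (-(1 / 2) *
    (inner ℝ (G (θ - b)) (θ - b) - 2 * inner ℝ (θ - b) (score C v t x b y)))) with hW
  have hWm : Measurable W := by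
    refine Measurable.ennreal_ofReal (Continuous.measurable ?_)
    fun_prop
  have hlik : ∀ w, likelihood C v t x y w = ENNReal.ofReal c * W (evalAt t w) := fun w => by
    rw [likelihood, hc, ENNReal.ofReal_mul hc0.le]
  have hlaw : P.map (evalAt t) = (stdGaussian (EuclideanSpace ℝ (Fin l))).map T := by
    rw [hP.map_evalAt, multivariateGaussian]
    simp [hT]
  have hself : ∀ (M : Matrix (Fin l) (Fin l) ℝ), Mᵀ = M → ∀ u w : EuclideanSpace ℝ (Fin l),
      inner ℝ (Matrix.toEuclideanCLM (𝕜 := ℝ) M u) w =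
        inner ℝ u (Matrix.toEuclideanCLM (𝕜 := ℝ) M w) := by
    intro M hM u w
    rw [real_inner_comm, Matrix.inner_toEuclideanCLM, Matrix.inner_toEuclideanCLM,
      Matrix.dotProduct_mulVec, ← Matrix.mulVec_transpose, hM, dotProduct_comm]
  have hsqrt : (CFC.sqrt (covMatrix C t t))ᵀ = CFC.sqrt (covMatrix C t t) := by
    have h := (CFC.sqrt_nonneg (covMatrix C t t)).isSelfAdjoint
    rwa [IsSelfAdjoint, Matrix.star_eq_conjTranspose,
      Matrix.conjTranspose_eq_transpose_of_trivial] at h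
  have hsq : CFC.sqrt (covMatrix C t t) * CFC.sqrt (covMatrix C t t) = covMatrix C t t := by
    exact CFC.sqrt_mul_sqrt_self _ ht.posSemidef.nonneg
  have hTp : T (T (WithLp.toLp 2 ((covMatrix C t t)⁻¹ *ᵥ b.ofLp))) = b := by
    rw [hT, ← ContinuousLinearMap.comp_apply, ← ContinuousLinearMap.mul_def, ← map_mul, hsq]
    ext i
    simp [Matrix.mulVec_mulVec, Matrix.mul_nonsing_inv _ ((Matrix.isUnit_iff_isUnit_det _).1
      ht.isUnit)]
  have key := lintegral_sq_mul_gaussian_tilt_le (T := T) (G := G) (g := score C v t x b y)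
    (hself _ hsqrt) (hself _ (transpose_infoMatrix hS)) hlam
    (fun u => by rw [real_inner_comm, hGdef, Matrix.inner_toEuclideanCLM]; exact hG u) hTp
  rw [← hlaw, finrank_euclideanSpace_fin] at key
  rw [lintegral_map (f := fun θ => ‖θ - b‖ₑ ^ 2 * W θ) (by fun_prop) (measurable_evalAt t),
    lintegral_map (f := W) hWm (measurable_evalAt t)] at key
  have hWe : Measurable fun w : D → ℝ => W (evalAt t w) := hWm.comp (measurable_evalAt t)
  have hee : Measurable fun w : D → ℝ => ‖evalAt t w - b‖ₑ ^ 2 := by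
    have := measurable_evalAt t
    fun_prop
  rw [posterior, lintegral_smul_measure,
    lintegral_withDensity_eq_lintegral_mul _ (measurable_likelihood hS y) hee, smul_eq_mul]
  have h1 : ∫⁻ w, (likelihood C v t x y * fun w => ‖evalAt t w - b‖ₑ ^ 2) w ∂P =
      ENNReal.ofReal c * ∫⁻ w, ‖evalAt t w - b‖ₑ ^ 2 * W (evalAt t w) ∂P := by
    rw [← lintegral_const_mul (f := fun w => ‖evalAt t w - b‖ₑ ^ 2 * W (evalAt t w)) _
      (hee.mul hWe)]
    refine lintegral_congr fun w => ?_
    rw [Pi.mul_apply, hlik]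
    ring
  have h2 : ∫⁻ w, likelihood C v t x y w ∂P =
      ENNReal.ofReal c * ∫⁻ w, W (evalAt t w) ∂P := by
    rw [← lintegral_const_mul _ hWe]
    exact lintegral_congr fun w => hlik w
  set R := ENNReal.ofReal (2 * (‖score C v t x b y -
        WithLp.toLp 2 ((covMatrix C t t)⁻¹ *ᵥ b.ofLp)‖ / lam) ^ 2 + 8 * √2 ^ l / lam)
  calc (∫⁻ w, likelihood C v t x y w ∂P)⁻¹ *
        ∫⁻ w, (likelihood C v t x y * fun w => ‖evalAt t w - b‖ₑ ^ 2) w ∂P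
      ≤ (∫⁻ w, likelihood C v t x y w ∂P)⁻¹ * (R * ∫⁻ w, likelihood C v t x y w ∂P) := by
        rw [h1]
        refine mul_le_mul_right ?_ _
        rw [h2, mul_left_comm]
        exact mul_le_mul_right key _
    _ = R * ((∫⁻ w, likelihood C v t x y w ∂P)⁻¹ * ∫⁻ w, likelihood C v t x y w ∂P) :=
        mul_left_comm _ _ _
    _ ≤ R := mul_le_of_le_one_right' (ENNReal.inv_mul_le_one _)

/-- Under the true law the score is centred with covariance `AᵀΣ⁻¹ Σ Σ⁻¹A`, the information matrix,
so its mean square is the trace. -/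
lemma lintegral_posterior_bound_le (hS : (condCov C v t x).PosDef) {lam : ℝ} (hlam : 0 < lam)
    (b p : EuclideanSpace ℝ (Fin l)) {K : ℝ} (hK : 0 ≤ K) :
    ∫⁻ y, ENNReal.ofReal (2 * (‖score C v t x b y - p‖ / lam) ^ 2 + K) ∂dataLaw C v t x b ≤
      ENNReal.ofReal (4 / lam ^ 2 * ((infoMatrix C v t x).trace + ‖p‖ ^ 2) + K) := by
  have htrace := lintegral_sq_norm_mulVec_multivariateGaussian (μ := dataMean C t x b)
    hS.posSemidef ((regMatrix C t x)ᵀ * (condCov C v t x)⁻¹)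
  have hQ : (regMatrix C t x)ᵀ * (condCov C v t x)⁻¹ * condCov C v t x *
      ((regMatrix C t x)ᵀ * (condCov C v t x)⁻¹)ᵀ = infoMatrix C v t x := by
    rw [Matrix.transpose_mul, transpose_inv_condCov hS, Matrix.transpose_transpose,
      Matrix.mul_assoc (regMatrix C t x)ᵀ, Matrix.nonsing_inv_mul _
        ((Matrix.isUnit_iff_isUnit_det _).1 hS.isUnit), Matrix.mul_one, infoMatrix,
      Matrix.mul_assoc]
  rw [hQ] at htrace
  have htr0 : 0 ≤ (infoMatrix C v t x).trace := by
    have h := hS.inv.posSemidef.conjTranspose_mul_mul_same (regMatrix C t x)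
    rw [Matrix.conjTranspose_eq_transpose_of_trivial] at h
    exact h.trace_nonneg
  have hs : Continuous (score C v t x b) := continuous_score b
  have hpt : ∀ y, ENNReal.ofReal (2 * (‖score C v t x b y - p‖ / lam) ^ 2 + K) ≤
      ENNReal.ofReal (4 / lam ^ 2) * ENNReal.ofReal (‖score C v t x b y‖ ^ 2) +
        ENNReal.ofReal (4 / lam ^ 2 * ‖p‖ ^ 2 + K) := by
    intro y
    rw [← ENNReal.ofReal_mul (by positivity), ← ENNReal.ofReal_add (by positivity) (by positivity)]
    apply ENNReal.ofReal_le_ofReal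
    have h1 : ‖score C v t x b y - p‖ ^ 2 ≤ 2 * ‖score C v t x b y‖ ^ 2 + 2 * ‖p‖ ^ 2 := by
      have := norm_sub_le (score C v t x b y) p
      nlinarith [sq_nonneg (‖score C v t x b y‖ - ‖p‖), norm_nonneg (score C v t x b y - p)]
    have h2 : 2 * (‖score C v t x b y - p‖ / lam) ^ 2 =
        2 / lam ^ 2 * ‖score C v t x b y - p‖ ^ 2 := by
      rw [div_pow]
      ring
    have h3 : 2 / lam ^ 2 * ‖score C v t x b y - p‖ ^ 2 ≤
        2 / lam ^ 2 * (2 * ‖score C v t x b y‖ ^ 2 + 2 * ‖p‖ ^ 2) := by gcongr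
    rw [h2]
    refine (add_le_add_left h3 K).trans (le_of_eq ?_)
    ring
  have hprob : IsProbabilityMeasure (dataLaw C v t x b) := by
    unfold dataLaw
    infer_instance
  calc _ ≤ ∫⁻ y, (ENNReal.ofReal (4 / lam ^ 2) * ENNReal.ofReal (‖score C v t x b y‖ ^ 2) +
        ENNReal.ofReal (4 / lam ^ 2 * ‖p‖ ^ 2 + K)) ∂dataLaw C v t x b := lintegral_mono hpt
    _ = ENNReal.ofReal (4 / lam ^ 2) * ENNReal.ofReal (infoMatrix C v t x).trace +
        ENNReal.ofReal (4 / lam ^ 2 * ‖p‖ ^ 2 + K) := by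
        rw [lintegral_add_right _ measurable_const, lintegral_const, measure_univ, mul_one,
          lintegral_const_mul _ (by fun_prop), ← htrace]
        rfl
    _ = _ := by
        rw [← ENNReal.ofReal_mul (by positivity), ← ENNReal.ofReal_add (by positivity)
          (by positivity)]
        congr 1
        ring

end Posterior

end DISK

/-! ### Second moments of Wasserstein barycenters. -/

namespace DISK

section Barycenter

variable {E : Type*} [NormedAddCommGroup E] [MeasurableSpace E] [BorelSpace E]
  [SecondCountableTopology E]

lemma wassersteinSq_dirac_left_le (θ : E) (ν : Measure E) [IsProbabilityMeasure ν] :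
    wassersteinSq (Measure.dirac θ) ν ≤ ∫⁻ x, ‖x - θ‖ₑ ^ 2 ∂ν := by
  have hm : Measurable fun x : E => (θ, x) := by fun_prop
  have hcoupling : (ν.map fun x => (θ, x)).map Prod.fst = Measure.dirac θ ∧
      (ν.map fun x => (θ, x)).map Prod.snd = ν := by
    refine ⟨?_, ?_⟩
    · rw [Measure.map_map measurable_fst hm]
      change ν.map (fun _ => θ) = _
      rw [Measure.map_const, measure_univ, one_smul]
    · rw [Measure.map_map measurable_snd hm]
      exact Measure.map_id
  refine iInf_le_of_le (ν.map fun x => (θ, x)) (iInf_le_of_le hcoupling ?_)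
  rw [lintegral_map (by fun_prop) hm]
  refine lintegral_mono fun x => ?_
  rw [edist_comm, edist_eq_enorm_sub]

/-- The triangle inequality and `(a + b)² ≤ 2a² + 2b²` give this under every coupling; then take the
infimum. -/
lemma lintegral_sq_sub_le_wassersteinSq (θ : E) (μ ν : Measure E) :
    ∫⁻ x, ‖x - θ‖ₑ ^ 2 ∂μ ≤ 2 * wassersteinSq μ ν + 2 * ∫⁻ x, ‖x - θ‖ₑ ^ 2 ∂ν := by
  unfold wassersteinSq
  rw [ENNReal.mul_iInf_of_ne (by norm_num) (by norm_num), ENNReal.iInf_add]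
  refine le_iInf fun π => ?_
  rw [ENNReal.mul_iInf_of_ne (by norm_num) (by norm_num), ENNReal.iInf_add]
  refine le_iInf fun hπ => ?_
  obtain ⟨rfl, rfl⟩ := hπ
  rw [lintegral_map (by fun_prop) measurable_fst, lintegral_map (by fun_prop) measurable_snd,
    ← lintegral_const_mul _ (by fun_prop), ← lintegral_const_mul _ (by fun_prop),
    ← lintegral_add_left (by fun_prop)]
  refine lintegral_mono fun p => ?_
  have h : ‖p.1 - θ‖ₑ ≤ edist p.1 p.2 + ‖p.2 - θ‖ₑ := by
    rw [edist_eq_enorm_sub, ← sub_add_sub_cancel p.1 p.2 θ]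
    exact enorm_add_le _ _
  calc ‖p.1 - θ‖ₑ ^ 2 ≤ (edist p.1 p.2 + ‖p.2 - θ‖ₑ) ^ 2 := by gcongr
    _ ≤ 2 * (edist p.1 p.2 ^ 2 + ‖p.2 - θ‖ₑ ^ 2) := by
      have := ENNReal.rpow_add_le_mul_rpow_add_rpow (edist p.1 p.2) ‖p.2 - θ‖ₑ one_le_two
      norm_num at this
      exact this
    _ = _ := mul_add _ _ _

/-- The second moment of a Wasserstein barycenter about a point is bounded by the average of the
second moments of the laws. -/
lemma IsBarycenter.lintegral_sq_le {k : ℕ} (hk : k ≠ 0) {νs : Fin k → Measure E} {ν : Measure E}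
    [∀ j, IsProbabilityMeasure (νs j)] (hν : IsBarycenter νs ν) (θ : E) :
    ∫⁻ x, ‖x - θ‖ₑ ^ 2 ∂ν ≤ 4 * ((k : ℝ≥0∞)⁻¹ * ∑ j, ∫⁻ x, ‖x - θ‖ₑ ^ 2 ∂νs j) := by
  have hdirac : MemP2 (Measure.dirac θ) := by
    refine ⟨inferInstance, ?_⟩
    rw [lintegral_dirac]
    exact ENNReal.pow_lt_top enorm_lt_top
  have hkt : (k : ℝ≥0∞) ≠ ∞ := ENNReal.natCast_ne_top k
  have hk0 : (k : ℝ≥0∞) ≠ 0 := by exact_mod_cast hk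
  set S := (k : ℝ≥0∞)⁻¹ * ∑ j, ∫⁻ x, ‖x - θ‖ₑ ^ 2 ∂νs j with hS
  -- Minimality is tested against the Dirac mass at `θ`.
  have h1 : (k : ℝ≥0∞)⁻¹ * ∑ j, wassersteinSq ν (νs j) ≤ S :=
    (hν.2 _ hdirac).trans
      (mul_le_mul_right (Finset.sum_le_sum fun j _ => wassersteinSq_dirac_left_le θ (νs j)) _)
  calc ∫⁻ x, ‖x - θ‖ₑ ^ 2 ∂ν = (k : ℝ≥0∞)⁻¹ * ∑ _j : Fin k, ∫⁻ x, ‖x - θ‖ₑ ^ 2 ∂ν := by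
        rw [Finset.sum_const, Finset.card_univ, Fintype.card_fin, nsmul_eq_mul, ← mul_assoc,
          ENNReal.inv_mul_cancel hk0 hkt, one_mul]
    _ ≤ (k : ℝ≥0∞)⁻¹ * ∑ j, (2 * wassersteinSq ν (νs j) + 2 * ∫⁻ x, ‖x - θ‖ₑ ^ 2 ∂νs j) := by
        gcongr with j
        exact lintegral_sq_sub_le_wassersteinSq θ ν (νs j)
    _ = 2 * ((k : ℝ≥0∞)⁻¹ * ∑ j, wassersteinSq ν (νs j)) + 2 * S := by
        rw [Finset.sum_add_distrib, ← Finset.mul_sum, ← Finset.mul_sum, hS]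
        ring
    _ ≤ 2 * S + 2 * S := by gcongr
    _ = 4 * S := by ring

end Barycenter

/-! ### Covering numbers against Gaussian small-ball probabilities. -/

section Entropy

lemma exists_finset_of_ballCoverNumber_le {X : Type*} [AddGroup X] {N : X → ℝ} {ε : ℝ} {F : Set X}
    {a : ℝ} (ha : 0 ≤ a)
    (h : ((ballCoverNumber N ε F : ℕ∞) : ℝ≥0∞) ≤ ENNReal.ofReal a) :
    ∃ T : Finset X, (∀ f ∈ F, ∃ g ∈ T, N (f - g) ≤ ε) ∧ (T.card : ℝ) ≤ a := by
  obtain ⟨n, hn⟩ : ∃ n : ℕ, ballCoverNumber N ε F = n := by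
    refine ⟨(ballCoverNumber N ε F).toNat, (ENat.natCast_toNat fun htop => ?_).symm⟩
    rw [htop] at h
    simp at h
  -- A strict bound on the infimum yields an actual cover; with `n + 1` it has at most `n` centres.
  have hlt : ballCoverNumber N ε F < (n + 1 : ℕ) := by
    rw [hn]
    exact_mod_cast Nat.lt_succ_self n
  unfold ballCoverNumber at hlt
  obtain ⟨T, hT⟩ := iInf_lt_iff.1 hlt
  obtain ⟨hcov, hcard⟩ := iInf_lt_iff.1 hT
  refine ⟨T, hcov, ?_⟩
  rw [hn, ENat.toENNReal_coe, ← ENNReal.ofReal_natCast, ENNReal.ofReal_le_ofReal_iff ha] at h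
  have : T.card < n + 1 := by exact_mod_cast hcard
  exact le_trans (by exact_mod_cast Nat.lt_succ_iff.1 this) h

/-- Small balls of a Gaussian law on the real line. -/
lemma gaussianReal_abs_sub_le {v : NNReal} (hv : v ≠ 0) (μ a r : ℝ) :
    gaussianReal μ v {z | |z - a| ≤ r} ≤ ENNReal.ofReal ((√(2 * Real.pi * v))⁻¹ * (2 * r)) := by
  have hset : {z : ℝ | |z - a| ≤ r} = Set.Icc (a - r) (a + r) := by
    ext z
    rw [Set.mem_ofPred_eq, abs_le, Set.mem_Icc]
    constructor <;> rintro ⟨h1, h2⟩ <;> constructor <;> linarith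
  rw [hset, gaussianReal_apply μ hv]
  calc ∫⁻ z in Set.Icc (a - r) (a + r), gaussianPDF μ v z
      ≤ ∫⁻ _ in Set.Icc (a - r) (a + r), ENNReal.ofReal (√(2 * Real.pi * v))⁻¹ := by
        refine lintegral_mono fun z => ENNReal.ofReal_le_ofReal ?_
        rw [gaussianPDFReal]
        refine mul_le_of_le_one_right (by positivity) (Real.exp_le_one_iff.2 ?_)
        rw [neg_div]
        exact neg_nonpos.2 (by positivity)
    _ = _ := by
        rw [setLIntegral_const, Real.volume_Icc, ← ENNReal.ofReal_mul (by positivity)]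
        congr 2
        ring

variable {D : Type*} {C : D → D → ℝ} {P : Measure (D → ℝ)} {l : ℕ}

/-- A set of prior mass at least `1 / 2` that is covered by few small balls of a seminorm which
dominates the values at the location `s`: the number of balls is inversely proportional to the
radius. -/
lemma IsGPPrior.one_le_cover_mul_radius (hP : IsGPPrior C P) {s : D} (hs : 0 < C s s)
    {F : Set (D → ℝ)} (hF : 1 / 2 ≤ P.real F) {T : Finset (D → ℝ)} {r : ℝ} (hr : 0 ≤ r)
    (hT : ∀ f ∈ F, ∃ g ∈ T, |f s - g s| ≤ r) :
    1 ≤ T.card * (4 * (√(2 * Real.pi * C s s))⁻¹ * r) := by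
  have hprob := hP.gaussian.isProbabilityMeasure
  have hlaw : P.map (fun w : D → ℝ => w s) = gaussianReal 0 (C s s).toNNReal := by
    rw [(hP.gaussian.hasGaussianLaw_eval s).map_eq_gaussianReal, hP.mean_zero,
      ← covariance_self (measurable_pi_apply s).aemeasurable, hP.cov]
  have hv : (C s s).toNNReal ≠ 0 := by simpa using hs
  have hball : ∀ g : D → ℝ, P.real {f | |f s - g s| ≤ r} ≤
      (√(2 * Real.pi * C s s))⁻¹ * (2 * r) := by
    intro g
    have h := gaussianReal_abs_sub_le hv 0 (g s) r
    rw [← hlaw, Measure.map_apply (measurable_pi_apply s) (by measurability),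
      Real.coe_toNNReal _ hs.le] at h
    exact ENNReal.toReal_le_of_le_ofReal (by positivity) h
  have hsub : F ⊆ ⋃ g ∈ T, {f | |f s - g s| ≤ r} := fun f hf => by
    obtain ⟨g, hg, hgr⟩ := hT f hf
    exact Set.mem_biUnion (x := g) hg hgr
  have h1 : P.real F ≤ T.card * ((√(2 * Real.pi * C s s))⁻¹ * (2 * r)) := by
    calc P.real F ≤ P.real (⋃ g ∈ T, {f | |f s - g s| ≤ r}) := measureReal_mono hsub (measure_ne_top _ _)
      _ ≤ ∑ g ∈ T, P.real {f | |f s - g s| ≤ r} := measureReal_biUnion_finset_le _ _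
      _ ≤ ∑ _g ∈ T, (√(2 * Real.pi * C s s))⁻¹ * (2 * r) := Finset.sum_le_sum fun g _ => hball g
      _ = _ := by rw [Finset.sum_const, nsmul_eq_mul]
  linarith

end Entropy

end DISK

/-! ### Risk of order `1 / m`, and comparison with the rate. -/

namespace DISK

section Risk

variable {D : Type*} {C : D → D → ℝ} {P : Measure (D → ℝ)} {ι : Type*} [Fintype ι]
  [DecidableEq ι] {l : ℕ} {t : Fin l → D} {x : ι → D} {v : ℝ}

/-- Evaluating the norm bound at the standard basis vectors controls the diagonal entries. -/
lemma trace_infoMatrix_le [Nonempty ι] (hS : (condCov C v t x).PosDef) {M : ℝ}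
    (hM : ∀ b : EuclideanSpace ℝ (Fin l), dataNorm C v t x b ^ 2 ≤ M * ‖b‖ ^ 2) :
    (infoMatrix C v t x).trace ≤ Fintype.card ι * (M * l) := by
  have hN : (0 : ℝ) < Fintype.card ι := by exact_mod_cast Fintype.card_pos
  have hdiag : ∀ a, infoMatrix C v t x a a ≤ Fintype.card ι * M := by
    intro a
    have h := hM (EuclideanSpace.single a 1)
    have hq : (EuclideanSpace.single a (1 : ℝ)).ofLp ⬝ᵥ
        infoMatrix C v t x *ᵥ (EuclideanSpace.single a (1 : ℝ)).ofLp = infoMatrix C v t x a a := by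
      simp
    rw [dataNorm_sq hS, hq] at h
    simp only [PiLp.norm_single, norm_one, one_pow, mul_one] at h
    rwa [one_div, inv_mul_le_iff₀ hN] at h
  calc (infoMatrix C v t x).trace ≤ ∑ _a : Fin l, Fintype.card ι * M :=
        Finset.sum_le_sum fun a _ => hdiag a
    _ = Fintype.card ι * (M * l) := by
        rw [Finset.sum_const, Finset.card_univ, Fintype.card_fin, nsmul_eq_mul]
        ring

/-- If the data norm is equivalent to the Euclidean norm, then the risk of the posterior law of the
test values is of the order of the inverse sample size. -/
lemma exists_posterior_risk_bound [Nonempty ι] (hP : IsGPPrior C P)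
    (ht : (covMatrix C t t).PosDef) (hS : (condCov C v t x).PosDef) {a M : ℝ} (ha : 0 < a)
    (hlow : ∀ b : EuclideanSpace ℝ (Fin l), a * ‖b‖ ^ 2 ≤ dataNorm C v t x b ^ 2)
    (hM : ∀ b : EuclideanSpace ℝ (Fin l), dataNorm C v t x b ^ 2 ≤ M * ‖b‖ ^ 2)
    (b : EuclideanSpace ℝ (Fin l)) :
    ∃ R : EuclideanSpace ℝ ι → ℝ≥0∞, Measurable R ∧
      (∀ y, ∫⁻ w, ‖evalAt t w - b‖ₑ ^ 2 ∂posterior C v t P x y ≤ R y) ∧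
      ∫⁻ y, R y ∂dataLaw C v t x b ≤ ENNReal.ofReal
        ((4 / a ^ 2 * (M * l + ‖(WithLp.toLp 2 ((covMatrix C t t)⁻¹ *ᵥ b.ofLp) :
          EuclideanSpace ℝ (Fin l))‖ ^ 2) + 8 * √2 ^ l / a) / Fintype.card ι) := by
  have hN1 : (1 : ℝ) ≤ Fintype.card ι := by exact_mod_cast Fintype.card_pos
  have htr := trace_infoMatrix_le hS hM
  set N : ℝ := (Fintype.card ι : ℝ)
  have hN : 0 < N := by linarith
  set p : EuclideanSpace ℝ (Fin l) := WithLp.toLp 2 ((covMatrix C t t)⁻¹ *ᵥ b.ofLp)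
  have hlam : 0 < N * a := by positivity
  have hG : ∀ u : EuclideanSpace ℝ (Fin l),
      N * a * ‖u‖ ^ 2 ≤ u.ofLp ⬝ᵥ infoMatrix C v t x *ᵥ u.ofLp := by
    intro u
    have h := hlow u
    rwa [dataNorm_sq hS, one_div, le_inv_mul_iff₀ hN, ← mul_assoc] at h
  have hs : Continuous (score C v t x b) := continuous_score b
  refine ⟨fun y => ENNReal.ofReal (2 * (‖score C v t x b y - p‖ / (N * a)) ^ 2 +
    8 * √2 ^ l / (N * a)), by fun_prop,
    fun y => lintegral_sq_posterior_le hP ht hS hlam hG b y,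
    (lintegral_posterior_bound_le hS hlam b p (by positivity)).trans
      (ENNReal.ofReal_le_ofReal ?_)⟩
  -- The trace is of order `N` against `N²` in the denominator; the prior term `‖p‖²` is enlarged to
  -- `N * ‖p‖²` to share this scaling.
  calc 4 / (N * a) ^ 2 * ((infoMatrix C v t x).trace + ‖p‖ ^ 2) + 8 * √2 ^ l / (N * a)
      ≤ 4 / (N * a) ^ 2 * (N * (M * l) + N * ‖p‖ ^ 2) + 8 * √2 ^ l / (N * a) := by
        gcongr
        exact le_mul_of_one_le_left (sq_nonneg _) hN1
    _ = (4 / a ^ 2 * (M * l + ‖p‖ ^ 2) + 8 * √2 ^ l / a) / N := by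
        field_simp

lemma lintegral_sq_testPosterior (b : EuclideanSpace ℝ (Fin l)) (y : EuclideanSpace ℝ ι) :
    ∫⁻ θ, ‖θ - b‖ₑ ^ 2 ∂testPosterior C v t P x y =
      ∫⁻ w, ‖evalAt t w - b‖ₑ ^ 2 ∂posterior C v t P x y := by
  rw [testPosterior, lintegral_map (by fun_prop) (measurable_evalAt t)]

end Risk

/-- The risk of the barycenter of the subset posteriors is at most four times a common bound on the
risks of the subset posteriors. -/
lemma lintegral_barycenter_risk_le {D : Type*} {C : D → D → ℝ} {P : Measure (D → ℝ)}
    [IsProbabilityMeasure P] {l k m : ℕ} {t : Fin l → D} {x : Fin k → Fin m → D} {v : ℝ}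
    (hk : k ≠ 0) (hSfull : (condCov C v t (fullLoc x)).PosDef)
    (hS : ∀ j, (condCov C v t (x j)).PosDef) (b : EuclideanSpace ℝ (Fin l)) {r : ℝ≥0∞}
    {R : Fin k → EuclideanSpace ℝ (Fin m) → ℝ≥0∞} (hR : ∀ j, Measurable (R j))
    (hle : ∀ j y, ∫⁻ w, ‖evalAt t w - b‖ₑ ^ 2 ∂posterior C v t P (x j) y ≤ R j y)
    (hr : ∀ j, ∫⁻ y, R j y ∂dataLaw C v t (x j) b ≤ r)
    {Pbar : EuclideanSpace ℝ (Fin k × Fin m) → Measure (EuclideanSpace ℝ (Fin l))}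
    (hbar : ∀ y, IsBarycenter (fun j => testPosterior C v t P (x j) (subsetData y j)) (Pbar y)) :
    ∫⁻ y, ∫⁻ θ, ‖θ - b‖ₑ ^ 2 ∂Pbar y ∂dataLaw C v t (fullLoc x) b ≤ 4 * r := by
  have hkt : (k : ℝ≥0∞) ≠ ∞ := ENNReal.natCast_ne_top k
  have hk0 : (k : ℝ≥0∞) ≠ 0 := by exact_mod_cast hk
  have hmeas : ∀ j, Measurable fun y : EuclideanSpace ℝ (Fin k × Fin m) => R j (subsetData y j) :=
    fun j => (hR j).comp (measurable_subsetData j)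
  -- `Pbar` need not depend measurably on `y`, so a measurable bound is put in its place before
  -- integrating.
  have hpt : ∀ y, ∫⁻ θ, ‖θ - b‖ₑ ^ 2 ∂Pbar y ≤
      4 * ((k : ℝ≥0∞)⁻¹ * ∑ j, R j (subsetData y j)) := by
    intro y
    have hprob : ∀ j, IsProbabilityMeasure (testPosterior C v t P (x j) (subsetData y j)) := by
      intro j
      have := isProbabilityMeasure_posterior (P := P) (hS j) (subsetData y j)
      exact Measure.isProbabilityMeasure_map (measurable_evalAt t).aemeasurable
    refine ((hbar y).lintegral_sq_le hk b).trans ?_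
    gcongr with j
    rw [lintegral_sq_testPosterior]
    exact hle j _
  calc _ ≤ ∫⁻ y, 4 * ((k : ℝ≥0∞)⁻¹ * ∑ j, R j (subsetData y j)) ∂dataLaw C v t (fullLoc x) b :=
        lintegral_mono hpt
    _ = 4 * ((k : ℝ≥0∞)⁻¹ * ∑ j, ∫⁻ y, R j y ∂dataLaw C v t (x j) b) := by
        have hsum : Measurable fun y : EuclideanSpace ℝ (Fin k × Fin m) =>
            ∑ j, R j (subsetData y j) := Finset.measurable_sum _ fun j _ => hmeas j
        rw [lintegral_const_mul _ (hsum.const_mul _), lintegral_const_mul _ hsum,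
          lintegral_finsetSum _ fun j _ => hmeas j]
        congr 2
        refine Finset.sum_congr rfl fun j _ => ?_
        rw [← map_subsetData_dataLaw hSfull b j, lintegral_map (hR j) (measurable_subsetData j)]
    _ ≤ 4 * ((k : ℝ≥0∞)⁻¹ * ∑ _j : Fin k, r) := by
        gcongr with j
        exact hr j
    _ = 4 * r := by
        rw [Finset.sum_const, Finset.card_univ, Fintype.card_fin, nsmul_eq_mul, ← mul_assoc _ _ r,
          ENNReal.inv_mul_cancel hk0 hkt, one_mul]

/-- A rate `ε` for which `exp (a m ε_m²)` balls of radius proportional to `ε_m` suffice is slower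
than the parametric rate. -/
lemma tendsto_mul_sq_atTop {a K : ℝ} (ha : 0 < a) (hK : 0 < K) {ε : ℕ → ℝ}
    (hε : Tendsto ε atTop (𝓝 0)) (hpos : ∀ m, 1 ≤ m → 0 < ε m)
    (h : ∀ m : ℕ, 1 ≤ m → 1 ≤ Real.exp (a * (m * ε m ^ 2)) * (K * ε m)) :
    Tendsto (fun m : ℕ => m * ε m ^ 2) atTop atTop := by
  have hlog : Tendsto (fun m => Real.log (K * ε m)) atTop atBot := by
    refine Real.tendsto_log_nhdsGT_zero.comp (tendsto_nhdsWithin_iff.2 ⟨?_, ?_⟩)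
    · simpa using hε.const_mul K
    · filter_upwards [eventually_ge_atTop 1] with m hm
      exact mul_pos hK (hpos m hm)
  -- Logarithms in `h` show that `m * ε m ^ 2` dominates this sequence.
  have hneg : Tendsto (fun m => a⁻¹ * -Real.log (K * ε m)) atTop atTop :=
    (tendsto_neg_atBot_atTop.comp hlog).const_mul_atTop (inv_pos.2 ha)
  refine tendsto_atTop_mono' _ ?_ hneg
  filter_upwards [eventually_ge_atTop 1] with m hm
  have hKε : 0 < K * ε m := mul_pos hK (hpos m hm)
  have h1 := Real.log_le_log one_pos (h m hm)
  rw [Real.log_one, Real.log_mul (Real.exp_pos _).ne' hKε.ne', Real.log_exp] at h1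
  rw [inv_mul_le_iff₀ ha]
  linarith

end DISK

/-- The posterior laws contract at the parametric rate `m ^ (-1 / 2)`, whereas the entropy condition
forces `m * ε m ^ 2 → ∞` as soon as there is a test location; so any positive value of the constant
is admissible. -/
theorem theorem3 :
    -- the constant `c(H_l)` depends on `H_l` only
    ∃ c : ℝ → ℝ, (∀ h : ℝ, 0 < h → h < 1 → 0 < c h) ∧
    ∀ (d l : ℕ) (D : Set (EuclideanSpace ℝ (Fin d)))
      -- covariance function, noise variance, GP prior, test locations, true function
      (C : D → D → ℝ) (τsq : ℝ) (P : Measure (D → ℝ)) (t : Fin l → D) (w₀ : D → ℝ)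
      -- for each subset size `m`: the number of subsets and the locations `s_{ji}`
      (k : ℕ → ℕ) (x : (m : ℕ) → Fin (k m) → Fin m → D)
      -- the constants and the rate
      (Hl Hu Cl Cu : ℝ) (ε : ℕ → ℝ),
      0 < τsq →
      DISK.IsGPPrior C P →
      (DISK.covMatrix C t t).PosDef →
      (∀ m, 1 ≤ m → 1 ≤ k m) →
      (∀ m j i a, x m j i ≠ t a) →
      -- compact domain
      IsCompact D →
      -- norm equivalence
      0 < Hl → Hl < 1 → 1 < Hu →
      (∀ m, 1 ≤ m → ∀ (j : Fin (k m)) (b : EuclideanSpace ℝ (Fin l)),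
        Hl * DISK.dataNorm C (τsq / k m) t (DISK.fullLoc (x m)) b
            ≤ DISK.dataNorm C (τsq / k m) t (x m j) b ∧
        DISK.dataNorm C (τsq / k m) t (x m j) b
            ≤ Hu * DISK.dataNorm C (τsq / k m) t (DISK.fullLoc (x m)) b) →
      -- metric entropy
      (∀ m, 1 ≤ m → 0 < ε m) →
      (∀ m : ℕ, 1 ≤ m → 1 ≤ Real.sqrt m * ε m) →
      Tendsto ε atTop (𝓝 0) →
      (∀ r : ℝ, 1 < r → ∀ m : ℕ, 1 ≤ m → ∃ F : Set (D → ℝ), MeasurableSet F ∧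
        ((DISK.ballCoverNumber
            (fun f => DISK.dataNorm C (τsq / k m) t (DISK.fullLoc (x m)) (DISK.evalAt t f))
            (ε m) F : ℕ∞) : ℝ≥0∞) ≤ ENNReal.ofReal (Real.exp (m * ε m ^ 2 * Hl ^ 2 * r ^ 2)) ∧
        1 - Real.exp (-(2 * m * ε m ^ 2 * r ^ 2)) ≤ P.real F) →
      -- prior thickness
      (∀ m : ℕ, 1 ≤ m →
        Real.exp (-(m * Hu ^ 2 * ε m ^ 2)) ≤
          P.real {w | DISK.dataNorm C (τsq / k m) t (DISK.fullLoc (x m))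
            (DISK.evalAt t w - DISK.evalAt t w₀) ≤ ε m}) →
      -- equivalence of the Euclidean norm and the data-dependent norm
      0 < Cl → 0 < Cu →
      (∀ m, 1 ≤ m → ∀ b : EuclideanSpace ℝ (Fin l),
        Cl * DISK.dataNorm C (τsq / k m) t (DISK.fullLoc (x m)) b ^ 2 ≤ ‖b‖ ^ 2 ∧
        ‖b‖ ^ 2 ≤ Cu * DISK.dataNorm C (τsq / k m) t (DISK.fullLoc (x m)) b ^ 2) →
      ∀ᶠ m : ℕ in atTop,
        -- the risk of each subset posterior
        (∀ j : Fin (k m),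
          ∫⁻ y, ∫⁻ w, ‖DISK.evalAt t w - DISK.evalAt t w₀‖ₑ ^ 2
              ∂(DISK.posterior C (τsq / k m) t P (x m j) y)
            ∂(DISK.dataLaw C (τsq / k m) t (x m j) (DISK.evalAt t w₀))
          ≤ ENNReal.ofReal (Cu * c Hl * ε m ^ 2)) ∧
        -- the risk of the Wasserstein barycenter of the subset posteriors of `w*`
        (∀ Pbar : EuclideanSpace ℝ (Fin (k m) × Fin m) → Measure (EuclideanSpace ℝ (Fin l)),
          (∀ y, DISK.IsBarycenter
            (fun j => DISK.testPosterior C (τsq / k m) t P (x m j) (DISK.subsetData y j))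
            (Pbar y)) →
          ∫⁻ y, ∫⁻ b, ‖b - DISK.evalAt t w₀‖ₑ ^ 2 ∂(Pbar y)
            ∂(DISK.dataLaw C (τsq / k m) t (DISK.fullLoc (x m)) (DISK.evalAt t w₀))
          ≤ ENNReal.ofReal (Cu ^ 2 * c Hl * ε m ^ 2)) := by

  refine ⟨fun _ => 1, fun _ _ _ => one_pos, ?_⟩
  intro d l D C τsq P t w₀ k x Hl Hu Cl Cu ε hτ hP ht hk _ _ hHl hHl1 hHu hequiv hε hmε hε0
    hentropy _ hCl hCu hnorm
  have hprob := hP.gaussian.isProbabilityMeasure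
  -- The entropy argument needs a test location; without one, the norm on `ℝ⁰` vanishes and both
  -- risks are zero.
  rcases Nat.eq_zero_or_pos l with rfl | hl
  · have hz : ∀ b : EuclideanSpace ℝ (Fin 0), ‖b‖ₑ ^ 2 = 0 := fun b => by
      rw [Subsingleton.elim b 0]
      simp
    refine Eventually.of_forall fun m => ⟨fun j => ?_, fun Pbar _ => ?_⟩ <;> simp [hz]
  have hrate : Tendsto (fun m : ℕ => m * ε m ^ 2) atTop atTop := by
    set s := t ⟨0, hl⟩ with hs
    have hCs : 0 < C s s := ht.diag_pos (i := ⟨0, hl⟩)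
    -- The factor `4` in `a` is `r²` for `r = 2`. In `K`, `√Cu` converts the radius from the data
    -- norm to the Euclidean norm, and the rest comes from `one_le_cover_mul_radius`.
    refine DISK.tendsto_mul_sq_atTop (a := 4 * Hl ^ 2)
      (K := 4 * (√(2 * Real.pi * C s s))⁻¹ * √Cu) (by positivity) (by positivity) hε0 hε ?_
    intro m hm
    have hεm := hε m hm
    obtain ⟨F, -, hcover, hmass⟩ := hentropy 2 one_lt_two m hm
    obtain ⟨T, hT, hcard⟩ := DISK.exists_finset_of_ballCoverNumber_le (Real.exp_pos _).le hcover
    have hone : 1 ≤ m * ε m ^ 2 := by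
      have := one_le_pow₀ (hmε m hm) (n := 2)
      rwa [mul_pow, Real.sq_sqrt (Nat.cast_nonneg m)] at this
    have hhalf : 1 / 2 ≤ P.real F := by
      have h1 : Real.exp (-(2 * m * ε m ^ 2 * 2 ^ 2)) ≤ Real.exp (-1) :=
        Real.exp_le_exp.2 (by linarith)
      have h2 := Real.exp_neg_one_lt_half
      linarith
    have hclose : ∀ f ∈ F, ∃ g ∈ T, |f s - g s| ≤ √Cu * ε m := by
      intro f hf
      obtain ⟨g, hg, hfg⟩ := hT f hf
      refine ⟨g, hg, ?_⟩
      have h1 := (hnorm m hm (DISK.evalAt t (f - g))).2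
      have h2 : |f s - g s| ≤ ‖DISK.evalAt t (f - g)‖ := by
        have := PiLp.norm_apply_le (DISK.evalAt t (f - g)) (⟨0, hl⟩ : Fin l)
        simpa [DISK.evalAt, hs] using this
      have h3 : ‖DISK.evalAt t (f - g)‖ ^ 2 ≤ (√Cu * ε m) ^ 2 := by
        rw [mul_pow, Real.sq_sqrt hCu.le]
        refine h1.trans (mul_le_mul_of_nonneg_left ?_ hCu.le)
        exact pow_le_pow_left₀ (DISK.dataNorm_nonneg _) hfg 2
      exact h2.trans (abs_le_of_sq_le_sq' h3 (by positivity)).2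
    have h := hP.one_le_cover_mul_radius hCs hhalf (by positivity) hclose
    calc (1 : ℝ) ≤ T.card * (4 * (√(2 * Real.pi * C s s))⁻¹ * (√Cu * ε m)) := h
      _ ≤ Real.exp (m * ε m ^ 2 * Hl ^ 2 * 2 ^ 2) *
          (4 * (√(2 * Real.pi * C s s))⁻¹ * (√Cu * ε m)) := by gcongr
      _ = _ := by
        congr 1
        · congr 1
          ring
        · ring
  set p : EuclideanSpace ℝ (Fin l) :=
    WithLp.toLp 2 ((DISK.covMatrix C t t)⁻¹ *ᵥ (DISK.evalAt t w₀).ofLp) with hp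
  -- `a` and `M` compare the squared subset norm with `‖b‖²`, passing through the full-data norm;
  -- they do not depend on `m` or `j`, hence neither does `B`.
  set a := Hl ^ 2 / Cu with ha
  set M := Hu ^ 2 / Cl with hM
  set B := 4 / a ^ 2 * (M * l + ‖p‖ ^ 2) + 8 * √2 ^ l / a with hB
  have ha0 : 0 < a := by positivity
  -- These thresholds amount to `B / m ≤ Cu * ε m ^ 2` and, with the factor four of the barycenter,
  -- `4 * B / m ≤ Cu ^ 2 * ε m ^ 2`.
  filter_upwards [eventually_ge_atTop 1, hrate.eventually_ge_atTop (B / Cu),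
    hrate.eventually_ge_atTop (4 * B / Cu ^ 2)] with m hm hB1 hB2
  have hm0 : (0 : ℝ) < m := by exact_mod_cast hm
  have hkm : 0 < k m := hk m hm
  have hv : 0 < τsq / k m := div_pos hτ (by exact_mod_cast hkm)
  have hne : Nonempty (Fin m) := ⟨⟨0, hm⟩⟩
  have hS : ∀ j, (DISK.condCov C (τsq / k m) t (x m j)).PosDef := fun j =>
    hP.posDef_condCov ht hv (x m j)
  have hbound := fun j => DISK.exists_posterior_risk_bound (a := a) (M := M) hP ht (hS j) ha0
    (fun b => by
      have h1 := pow_le_pow_left₀ (mul_nonneg hHl.le (DISK.dataNorm_nonneg _)) (hequiv m hm j b).1 2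
      refine le_trans ?_ h1
      have h2 := (hnorm m hm b).2
      rw [mul_pow, ha, div_mul_eq_mul_div, div_le_iff₀ hCu]
      nlinarith [sq_nonneg Hl])
    (fun b => by
      have h1 := pow_le_pow_left₀ (DISK.dataNorm_nonneg _) (hequiv m hm j b).2 2
      refine h1.trans ?_
      have h2 := (hnorm m hm b).1
      rw [mul_pow, hM, div_mul_eq_mul_div, le_div_iff₀ hCl]
      nlinarith [sq_nonneg Hu])
    (DISK.evalAt t w₀)
  rw [← hp, ← hB, Fintype.card_fin] at hbound
  choose R hR hle hRint using hbound
  refine ⟨fun j => ?_, fun Pbar hbar => ?_⟩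
  · refine (lintegral_mono (hle j)).trans ((hRint j).trans (ENNReal.ofReal_le_ofReal ?_))
    rw [div_le_iff₀ hCu] at hB1
    rw [div_le_iff₀ hm0]
    linarith
  · refine (DISK.lintegral_barycenter_risk_le hkm.ne' (hP.posDef_condCov ht hv _) hS _ hR hle hRint
      hbar).trans ?_
    rw [show (4 : ℝ≥0∞) = ENNReal.ofReal 4 by simp, ← ENNReal.ofReal_mul (by norm_num)]
    refine ENNReal.ofReal_le_ofReal ?_
    rw [div_le_iff₀ (by positivity)] at hB2
    rw [← mul_div_assoc, div_le_iff₀ hm0]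
    linarith
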